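/- **Conventions.** Associators and unitors are suppressed, composition is written $\varphi.\psi$ (first $\psi$), and an object also denotes its identity morphism. A *duoidal category* is a category $\mathcal M$ with two monoidal structures $(\circ,I)$ and $(\bullet,J)$, morphisms $\delta:I\to I\bullet I$, $\varpi:J\circ J\to J$, $\tau:I\to J$ and a natural transformation $\zeta_{A,B,C,D}:(A\bullet B)\circ(C\bullet D)\to(A\circ C)\bullet(B\circ D)$ such that $(J,\varpi,\tau)$ is a monoid in $(\mathcal M,\circ)$, $(I,\delta,\tau)$ is a comonoid in $(\mathcal M,\bullet)$, the two associativity conditions $$\zeta.(\zeta\circ(E\bullet F))=\zeta.((A\bullet B)\circ\zeta):(A\bullet B)\circ(C\bullet D)\circ(E\bullet F)\to(A\circ C\circ E)\bullet(B\circ D\circ F),$$ $$(\zeta\bullet(C\circ F)).\zeta=((A\circ D)\bullet\zeta).\zeta:(A\bullet B\bullet C)\circ(D\bullet E\bullet F)\to(A\circ D)\bullet(B\circ E)\bullet(C\circ F)$$ hold, and each of the composites $\zeta.(\delta\circ(A\bullet B))$, $\zeta.((A\bullet B)\circ\delta)$, $(\varpi\bullet(A\circ B)).\zeta_{J,A,J,B}$,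 $((A\circ B)\bullet\varpi).\zeta_{A,J,B,J}$ is the identity. A *weak bimonoid* in $\mathcal M$ is an object $A$ with a monoid structure $(\mu,\eta)$ in $(\mathcal M,\circ)$ and a comonoid structure $(\Delta,\varepsilon)$ in $(\mathcal M,\bullet)$ such that $\Delta.\mu=(\mu\bullet\mu).\zeta.(\Delta\circ\Delta)$; such that, for $\Delta^2=(A\bullet\Delta).\Delta=(\Delta\bullet A).\Delta$ and $\delta'=(I\bullet\Delta.\eta).\delta:I\to I\bullet A\bullet A$, $\delta''=(\Delta.\eta\bullet I).\delta:I\to A\bullet A\bullet I$, the morphism $(I\bullet\Delta^2.\eta).\delta:I\to I\bullet A\bullet A\bullet A$ is equal to both composites $$(I\bullet A\bullet\mu\bullet A).(\zeta_{I,A,I\bullet A,A}\bullet A).(((I\bullet A)\circ\delta')\bullet A).\delta',\qquad (I\bullet A\bullet\mu\bullet A).(\zeta_{I\bullet A,A,I,A}\bullet A).((\delta'\circ(I\bullet A))\bullet A).\delta',$$ the morphism $(\Delta^2.\eta\bullet I).\delta:I\to A\bullet A\bullet A\bullet I$ is equal to both composites $$(A\bullet\mu\bullet A\bullet I).(A\bullet\zeta_{A,I,A,A\bullet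 I}).(A\bullet((A\bullet I)\circ\delta'')).\delta'',\qquad (A\bullet\mu\bullet A\bullet I).(A\bullet\zeta_{A,A\bullet I,A,I}).(A\bullet(\delta''\circ(A\bullet I))).\delta'',$$ and, for $e=\varpi.(J\circ\varepsilon.\mu):J\circ A\circ A\to J$ and $e'=\varpi.(\varepsilon.\mu\circ J):A\circ A\circ J\to J$, the morphism $\varpi.(J\circ\varepsilon).(J\circ\mu).(J\circ A\circ\mu):J\circ A\circ A\circ A\to J$ is equal to both composites $$e.((e\bullet(J\circ A))\circ A).(\zeta_{J\circ A,J,A,A}\circ A).(J\circ A\circ\Delta\circ A),\qquad e.(((J\circ A)\bullet e)\circ A).(\zeta_{J,J\circ A,A,A}\circ A).(J\circ A\circ\Delta\circ A),$$ and $\varpi.(\varepsilon\circ J).(\mu\circ J).(\mu\circ A\circ J):A\circ A\circ A\circ J\to J$ is equal to both composites $$e'.(A\circ(e'\bullet(A\circ J))).(A\circ\zeta_{A,A,A\circ J,J}).(A\circ\Delta\circ A\circ J),\qquad e'.(A\circ((A\circ J)\bullet e')).(A\circ\zeta_{A,A,J,A\circ J}).(A\circ\Delta\circ A\circ J).$$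 For a weak bimonoid $A$ put $$\sqcap=(\varepsilon.\mu\bullet A\bullet I).\zeta_{A,A\bullet I,A,I}.((\Delta.\eta\bullet I)\circ(A\bullet I)).(\delta\circ(A\bullet I)):A\bullet I\to A\bullet I.$$ For a splitting $\sqcap=\iota.\pi$, $\pi.\iota=L$, through an object $L$, equip $L$ with the multiplication $\pi.(\mu\bullet I).\zeta.(\iota\circ\iota)$, the unit $\pi.(\eta\bullet I).\delta$, the right $I$-coaction $(\pi\bullet I).(A\bullet\delta).\iota:L\to L\bullet I$ and the morphism $\omega=(A\bullet\tau).\iota:L\to A$. Let $\mathcal M_L$, $\mathcal M_A$ and $\mathcal M_J$ be the categories of right modules over $L$, $A$ and $J$ in $(\mathcal M,\circ)$, let $\mathcal M^I$ be the category of right $I$-comodules in $(\mathcal M,\bullet)$, and let $\mathcal M^I_L$ be the category of right $L$-modules in $\mathcal M^I$, i.e. of objects $X$ with an $L$-action $\xi$ and an $I$-coaction $\varrho$ such that $\varrho.\xi=(\xi\bullet I).\zeta.(\varrho\circ\varrho_L)$, where $\varrho_L$ is the coaction of $L$. For $P$ in $\mathcal M_L$ with action $\xi$, let $P\circ_L A$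 be the coequalizer in $\mathcal M$ of $\xi\circ A$ and $P\circ\mu.(\omega\circ A):P\circ L\circ A\to P\circ A$, with the $A$-action induced by $\mu$ (the coequalizer being preserved by $(-)\circ A$). Let $\widetilde{\mathcal M}_A$ be the category with the objects of $\mathcal M_L$ in which a morphism $P\to P'$ is a morphism $P\circ_LA\to P'\circ_LA$ of $A$-modules (the Kleisli category of the monad $(-)\circ_LA$ on $\mathcal M_L$). A functor $F:\mathcal C\to\mathcal D$ is *separable* if the natural transformation $\mathcal C(-,-)\to\mathcal D(F-,F-)$ given by $F$ has a natural retraction. A parallel pair $f,g:X\to Y$ is *contractible* if there is $t:Y\to X$ with $t.g=X$ and $f.t.f=g.t.f$; a *contractible equalizer* of it is a morphism $e:E\to X$ with $f.e=g.e$ for which there are $s:X\to E$, $t:Y\to X$ with $s.e=E$, $t.g=X$, $t.f=e.s$ (so $e$ is an absolute equalizer). For a functor $F$, the pair $f,g$ is *$F$-contractible* if the pair $Ff,Fg$ is contractible. **Proposition.** Let $(\mathcal M,\circ,\bullet)$ be a duoidal category in which idempotent morphisms split and for which the functor $\mathcal M^I\to\mathcal M\to\mathcal M_J$, the composite of the forgetful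 functor and of the free module functor $(-)\circ J$, is separable. Let $A$ be a weak bimonoid in $\mathcal M$. Then $\sqcap$ splits, for every splitting with object $L$ the tensor products $P\circ_LA$ exist for all $P$ in $\mathcal M_L$, and for all choices of these the functor $$\widetilde Y=(-)\circ_LA:\mathcal M^I_L\to\widetilde{\mathcal M}_A$$ has the following properties. 1. $\widetilde Y$ reflects isomorphisms. 2. Every $\widetilde Y$-contractible pair of morphisms of $\mathcal M^I_L$ has a contractible equalizer in $\mathcal M^I_L$. -/

import Mathlib

open CategoryTheory

universe v u v' u'

namespace WeakBim

/-! ## Generalities on functors -/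

section Functors

variable {C : Type u} [Category.{v} C] {D : Type u'} [Category.{v'} D]

/-- A functor `F` is separable if the natural transformation `Hom(X, Y) ⟶ Hom(F X, F Y)`,
`f ↦ F f`, of functors `Cᵒᵖ × C ⥤ Type` has a natural retraction `r`. -/
def IsSeparable (F : C ⥤ D) : Prop :=
  ∃ r : ∀ X Y : C, (F.obj X ⟶ F.obj Y) → (X ⟶ Y),
    (∀ (X Y : C) (f : X ⟶ Y), r X Y (F.map f) = f) ∧
    ∀ (X' X Y Y' : C) (h : X' ⟶ X) (g : F.obj X ⟶ F.obj Y) (k : Y ⟶ Y'),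
      r X' Y' (F.map h ≫ g ≫ F.map k) = h ≫ r X Y g ≫ k

/-- A parallel pair is contractible (in the sense relevant for equalizers) if some morphism `t`
backwards satisfies `g ≫ t = 𝟙` and `f ≫ t ≫ f = f ≫ t ≫ g`. The two morphisms of the pair play
different roles here, in the same order as in Mathlib's `IsSplitEqualizer f g e`, which is the
structure of a contractible equalizer `e` of the pair. -/
def IsContractiblePair {X Y : C} (f g : X ⟶ Y) : Prop :=
  ∃ t : Y ⟶ X, g ≫ t = 𝟙 X ∧ f ≫ t ≫ f = f ≫ t ≫ g

end Functors

/-! ## Modules and comodules in a monoidal category -/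

section Modules

open MonoidalCategory Limits

variable {V : Type u} [Category.{v} V] [MonoidalCategory V]

/-- Right modules over an object `M` with multiplication `mul` and unit `one`. (The monoid laws
of `M` do not enter the definition of its modules.) -/
structure RightMod (M : V) (mul : M ⊗ M ⟶ M) (one : 𝟙_ V ⟶ M) where
  X : V
  act : X ⊗ M ⟶ X
  act_one : X ◁ one ≫ act = (ρ_ X).hom
  act_act : act ▷ M ≫ act = (α_ X M M).hom ≫ X ◁ mul ≫ act

namespace RightMod

variable {M : V} {mul : M ⊗ M ⟶ M} {one : 𝟙_ V ⟶ M}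

/-- Morphisms of right modules. -/
@[ext]
structure Hom (P Q : RightMod M mul one) where
  hom : P.X ⟶ Q.X
  linear : P.act ≫ hom = hom ▷ M ≫ Q.act

instance : Category (RightMod M mul one) where
  Hom P Q := Hom P Q
  id P := ⟨𝟙 P.X, by simp⟩
  comp f g := ⟨f.hom ≫ g.hom, by
    rw [← Category.assoc, f.linear, Category.assoc, g.linear, comp_whiskerRight,
      Category.assoc]⟩
  id_comp _ := Hom.ext (Category.id_comp _)
  comp_id _ := Hom.ext (Category.comp_id _)
  assoc _ _ _ := Hom.ext (Category.assoc _ _ _)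

@[simp]
theorem id_hom (P : RightMod M mul one) : Hom.hom (𝟙 P) = 𝟙 P.X := rfl

@[simp]
theorem comp_hom {P Q R : RightMod M mul one} (f : P ⟶ Q) (g : Q ⟶ R) :
    Hom.hom (f ≫ g) = f.hom ≫ g.hom := rfl

end RightMod

/-- The free module functor `(-) ⊗ M` from a monoidal category to the category of right modules
over a monoid `M`. -/
def freeRightMod (M : V) [MonObj M] :
    V ⥤ RightMod M (MonObj.mul (X := M)) (MonObj.one (X := M)) where
  obj X :=
    { X := X ⊗ M
      act := (α_ X M M).hom ≫ X ◁ MonObj.mul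
      act_one := by
        have h := MonObj.mul_one M
        rw [associator_naturality_right_assoc, ← whiskerLeft_comp, h]
        simp
      act_act := by
        have h := MonObj.mul_assoc M
        rw [comp_whiskerRight, Category.assoc, whisker_assoc]
        simp only [Category.assoc, Iso.inv_hom_id_assoc, ← whiskerLeft_comp, h]
        simp }
  map f := ⟨f ▷ M, by
    dsimp only
    rw [Category.assoc, whisker_exchange, ← associator_naturality_left_assoc]⟩
  map_id X := RightMod.Hom.ext (id_whiskerRight X M)
  map_comp f g := RightMod.Hom.ext (comp_whiskerRight f g M)

/-- Right comodules over a comonoid. -/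
structure RightComod (K : V) [ComonObj K] where
  X : V
  coact : X ⟶ X ⊗ K
  coact_counit : coact ≫ X ◁ ComonObj.counit = (ρ_ X).inv
  coact_coact : coact ≫ coact ▷ K = coact ≫ X ◁ ComonObj.comul ≫ (α_ X K K).inv

namespace RightComod

variable {K : V} [ComonObj K]

/-- Morphisms of right comodules. -/
@[ext]
structure Hom (P Q : RightComod K) where
  hom : P.X ⟶ Q.X
  colinear : P.coact ≫ hom ▷ K = hom ≫ Q.coact

instance : Category (RightComod K) where
  Hom P Q := Hom P Q
  id P := ⟨𝟙 P.X, by simp⟩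
  comp f g := ⟨f.hom ≫ g.hom, by
    rw [comp_whiskerRight, ← Category.assoc, f.colinear, Category.assoc, g.colinear,
      Category.assoc]⟩
  id_comp _ := Hom.ext (Category.id_comp _)
  comp_id _ := Hom.ext (Category.comp_id _)
  assoc _ _ _ := Hom.ext (Category.assoc _ _ _)

/-- The functor forgetting the coaction. -/
def forget (K : V) [ComonObj K] : RightComod K ⥤ V where
  obj P := P.X
  map f := f.hom
  map_id _ := rfl
  map_comp _ _ := rfl

end RightComod

/-! ### Extension of scalars -/

section Extension

variable {L : V} {mul : L ⊗ L ⟶ L} {one : 𝟙_ V ⟶ L} {A : V} [MonObj A]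

/-- The category of right modules over a monoid `A`. -/
abbrev ModOver (A : V) [MonObj A] : Type _ :=
  RightMod A (MonObj.mul (X := A)) (MonObj.one (X := A))

/-- For a morphism `ω : L ⟶ A` and a right `L`-module `P`, the tensor product of `P` and `A`
over `L` (with left action `ω ▷ A ≫ μ` of `L` on `A`): a coequalizer `π` of the two morphisms
`(P ⊗ L) ⊗ A ⟶ P ⊗ A` given by the actions, which is preserved by `(-) ⊗ A`; together with the
`A`-module structure it carries, i.e. the unique one for which `π` is a morphism of `A`-modules
from the free module `P ⊗ A`. -/
structure RelTensor (ω : L ⟶ A) (P : RightMod L mul one) where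
  obj : ModOver A
  π : P.X ⊗ A ⟶ obj.X
  linear : π ▷ A ≫ obj.act = (α_ P.X A A).hom ≫ P.X ◁ MonObj.mul ≫ π
  w : P.act ▷ A ≫ π = ((α_ P.X L A).hom ≫ P.X ◁ (ω ▷ A ≫ MonObj.mul)) ≫ π
  isColimit : IsColimit (Cofork.ofπ π w)
  preserved : PreservesColimit
    (parallelPair (P.act ▷ A) ((α_ P.X L A).hom ≫ P.X ◁ (ω ▷ A ≫ MonObj.mul))) (tensorRight A)

variable {ω : L ⟶ A}

theorem RelTensor.hom_ext {P : RightMod L mul one} (T : RelTensor ω P) {Z : V}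
    {f g : T.obj.X ⟶ Z} (h : T.π ≫ f = T.π ≫ g) : f = g :=
  Cofork.IsColimit.hom_ext T.isColimit h

theorem RelTensor.hom_ext_whisker {P : RightMod L mul one} (T : RelTensor ω P) {Z : V}
    {f g : T.obj.X ⊗ A ⟶ Z} (h : T.π ▷ A ≫ f = T.π ▷ A ≫ g) : f = g :=
  haveI := T.preserved
  Cofork.IsColimit.hom_ext (isColimitCoforkMapOfIsColimit (tensorRight A) T.w T.isColimit) h

theorem RelTensor.exists_map {P P' : RightMod L mul one} (T : RelTensor ω P)
    (T' : RelTensor ω P') (f : P ⟶ P') :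
    ∃ g : T.obj ⟶ T'.obj, T.π ≫ g.hom = f.hom ▷ A ≫ T'.π := by
  have hf : P.act ▷ A ≫ f.hom ▷ A ≫ T'.π =
      ((α_ P.X L A).hom ≫ P.X ◁ (ω ▷ A ≫ MonObj.mul)) ≫ f.hom ▷ A ≫ T'.π := by
    have h1 : P.act ▷ A ≫ f.hom ▷ A = (f.hom ▷ L) ▷ A ≫ P'.act ▷ A := by
      rw [← comp_whiskerRight, f.linear, comp_whiskerRight]
    rw [reassoc_of% h1, T'.w]
    simp only [Category.assoc]
    rw [whisker_exchange_assoc, ← associator_naturality_left_assoc]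
  obtain ⟨g, hg⟩ := Cofork.IsColimit.desc' T.isColimit _ hf
  have hg' : T.π ≫ g = f.hom ▷ A ≫ T'.π := hg
  refine ⟨⟨g, T.hom_ext_whisker ?_⟩, hg'⟩
  rw [reassoc_of% T.linear, hg', ← comp_whiskerRight_assoc, hg', comp_whiskerRight,
    Category.assoc, T'.linear, whisker_exchange_assoc, ← associator_naturality_left_assoc]

/-- The morphism of `A`-modules induced on tensor products by a morphism of `L`-modules. -/
noncomputable def RelTensor.map {P P' : RightMod L mul one} (T : RelTensor ω P)
    (T' : RelTensor ω P') (f : P ⟶ P') : T.obj ⟶ T'.obj :=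
  (T.exists_map T' f).choose

theorem RelTensor.π_map {P P' : RightMod L mul one} (T : RelTensor ω P)
    (T' : RelTensor ω P') (f : P ⟶ P') :
    T.π ≫ (T.map T' f).hom = f.hom ▷ A ≫ T'.π :=
  (T.exists_map T' f).choose_spec

theorem RelTensor.map_id {P : RightMod L mul one} (T : RelTensor ω P) :
    T.map T (𝟙 P) = 𝟙 T.obj :=
  RightMod.Hom.ext <| T.hom_ext <| by
    rw [T.π_map, RightMod.id_hom, RightMod.id_hom, id_whiskerRight, Category.id_comp,
      Category.comp_id]

theorem RelTensor.map_comp {P P' P'' : RightMod L mul one} (T : RelTensor ω P)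
    (T' : RelTensor ω P') (T'' : RelTensor ω P'') (f : P ⟶ P') (g : P' ⟶ P'') :
    T.map T'' (f ≫ g) = T.map T' f ≫ T'.map T'' g :=
  RightMod.Hom.ext <| T.hom_ext <| by
    rw [T.π_map, RightMod.comp_hom, RightMod.comp_hom, comp_whiskerRight, Category.assoc,
      ← T'.π_map, ← Category.assoc, ← T.π_map T', Category.assoc]

/-- For a choice `T` of tensor products over `L`, the category whose objects are the
right `L`-modules and whose morphisms `P ⟶ P'` are the morphisms of `A`-modules between the
tensor products of `P` and of `P'` with `A` over `L`: the Kleisli category of the monad induced by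
extension and restriction of scalars, i.e. the full subcategory of its free modules inside the
category of `A`-modules. -/
abbrev KleisliCat (T : ∀ P : RightMod L mul one, RelTensor ω P) : Type _ :=
  InducedCategory (ModOver A) (fun P : RightMod L mul one => (T P).obj)

/-- Extension of scalars, as a functor to the Kleisli category. -/
noncomputable def extendScalars (T : ∀ P : RightMod L mul one, RelTensor ω P) :
    RightMod L mul one ⥤ KleisliCat T where
  obj P := P
  map {P P'} f := InducedCategory.homMk ((T P).map (T P') f)
  map_id P := InducedCategory.hom_ext (T P).map_id
  map_comp {P P' P''} f g := InducedCategory.hom_ext ((T P).map_comp (T P') (T P'') f g)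

end Extension

end Modules

/-! ## Duoidal categories -/

/-- Two monoidal structures on one category. The tensor product of the first one, `circ`, is
written `⊚`, and that of the second one, `bul`, is written `⊡`; structure morphisms and
whiskerings are decorated accordingly. -/
class TwoMonoidal (C : Type u) [Category.{v} C] where
  circ : MonoidalCategory C
  bul : MonoidalCategory C

notation:70 X:71 " ⊚ " Y:70 =>
  MonoidalCategoryStruct.tensorObj (self := TwoMonoidal.circ.toMonoidalCategoryStruct) X Y
notation:70 X:71 " ⊡ " Y:70 =>
  MonoidalCategoryStruct.tensorObj (self := TwoMonoidal.bul.toMonoidalCategoryStruct) X Y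
notation:70 f:71 " ⊚ₘ " g:70 =>
  MonoidalCategoryStruct.tensorHom (self := TwoMonoidal.circ.toMonoidalCategoryStruct) f g
notation:70 f:71 " ⊡ₘ " g:70 =>
  MonoidalCategoryStruct.tensorHom (self := TwoMonoidal.bul.toMonoidalCategoryStruct) f g
notation:81 X:82 " ◁⊚ " f:81 =>
  MonoidalCategoryStruct.whiskerLeft (self := TwoMonoidal.circ.toMonoidalCategoryStruct) X f
notation:81 f:81 " ▷⊚ " X:82 =>
  MonoidalCategoryStruct.whiskerRight (self := TwoMonoidal.circ.toMonoidalCategoryStruct) f X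
notation:81 X:82 " ◁⊡ " f:81 =>
  MonoidalCategoryStruct.whiskerLeft (self := TwoMonoidal.bul.toMonoidalCategoryStruct) X f
notation:81 f:81 " ▷⊡ " X:82 =>
  MonoidalCategoryStruct.whiskerRight (self := TwoMonoidal.bul.toMonoidalCategoryStruct) f X
notation "α⊚" =>
  MonoidalCategoryStruct.associator (self := TwoMonoidal.circ.toMonoidalCategoryStruct)
notation "α⊡" =>
  MonoidalCategoryStruct.associator (self := TwoMonoidal.bul.toMonoidalCategoryStruct)
notation "λ⊚" =>
  MonoidalCategoryStruct.leftUnitor (self := TwoMonoidal.circ.toMonoidalCategoryStruct)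
notation "λ⊡" =>
  MonoidalCategoryStruct.leftUnitor (self := TwoMonoidal.bul.toMonoidalCategoryStruct)
notation "ρ⊚" =>
  MonoidalCategoryStruct.rightUnitor (self := TwoMonoidal.circ.toMonoidalCategoryStruct)
notation "ρ⊡" =>
  MonoidalCategoryStruct.rightUnitor (self := TwoMonoidal.bul.toMonoidalCategoryStruct)

/-- The unit `I` of the monoidal structure `⊚`. -/
abbrev unitI (C : Type u) [Category.{v} C] [TwoMonoidal C] : C :=
  MonoidalCategoryStruct.tensorUnit (self := TwoMonoidal.circ.toMonoidalCategoryStruct) C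

/-- The unit `J` of the monoidal structure `⊡`. -/
abbrev unitJ (C : Type u) [Category.{v} C] [TwoMonoidal C] : C :=
  MonoidalCategoryStruct.tensorUnit (self := TwoMonoidal.bul.toMonoidalCategoryStruct) C

/-- Duoidal (also known as 2-monoidal) categories. -/
class Duoidal (C : Type u) [Category.{v} C] extends TwoMonoidal C where
  /-- the comultiplication `δ` of `I` -/
  δ : unitI C ⟶ unitI C ⊡ unitI C
  /-- the multiplication `ϖ` of `J` -/
  ϖ : unitJ C ⊚ unitJ C ⟶ unitJ C
  τ : unitI C ⟶ unitJ C
  /-- the interchange law -/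
  ζ (W X Y Z : C) : (W ⊡ X) ⊚ (Y ⊡ Z) ⟶ (W ⊚ Y) ⊡ (X ⊚ Z)
  ζ_natural {W X Y Z W' X' Y' Z' : C} (f : W ⟶ W') (g : X ⟶ X') (h : Y ⟶ Y') (k : Z ⟶ Z') :
    ((f ⊡ₘ g) ⊚ₘ (h ⊡ₘ k)) ≫ ζ W' X' Y' Z' = ζ W X Y Z ≫ ((f ⊚ₘ h) ⊡ₘ (g ⊚ₘ k))
  /-- `(J, ϖ, τ)` is a monoid for `⊚` -/
  unit_mul : τ ▷⊚ unitJ C ≫ ϖ = (λ⊚ (unitJ C)).hom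
  mul_unit : unitJ C ◁⊚ τ ≫ ϖ = (ρ⊚ (unitJ C)).hom
  mul_mul : ϖ ▷⊚ unitJ C ≫ ϖ =
    (α⊚ (unitJ C) (unitJ C) (unitJ C)).hom ≫ unitJ C ◁⊚ ϖ ≫ ϖ
  /-- `(I, δ, τ)` is a comonoid for `⊡` -/
  counit_comul : δ ≫ τ ▷⊡ unitI C = (λ⊡ (unitI C)).inv
  comul_counit : δ ≫ unitI C ◁⊡ τ = (ρ⊡ (unitI C)).inv
  comul_comul : δ ≫ unitI C ◁⊡ δ =
    δ ≫ δ ▷⊡ unitI C ≫ (α⊡ (unitI C) (unitI C) (unitI C)).hom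
  ζ_assoc_circ (X₁ X₂ Y₁ Y₂ Z₁ Z₂ : C) :
    ζ X₁ X₂ Y₁ Y₂ ▷⊚ (Z₁ ⊡ Z₂) ≫ ζ (X₁ ⊚ Y₁) (X₂ ⊚ Y₂) Z₁ Z₂ ≫
        ((α⊚ X₁ Y₁ Z₁).hom ⊡ₘ (α⊚ X₂ Y₂ Z₂).hom) =
      (α⊚ (X₁ ⊡ X₂) (Y₁ ⊡ Y₂) (Z₁ ⊡ Z₂)).hom ≫ (X₁ ⊡ X₂) ◁⊚ ζ Y₁ Y₂ Z₁ Z₂ ≫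
        ζ X₁ X₂ (Y₁ ⊚ Z₁) (Y₂ ⊚ Z₂)
  ζ_assoc_bul (X₁ X₂ X₃ Y₁ Y₂ Y₃ : C) :
    ζ (X₁ ⊡ X₂) X₃ (Y₁ ⊡ Y₂) Y₃ ≫ ζ X₁ X₂ Y₁ Y₂ ▷⊡ (X₃ ⊚ Y₃) ≫
        (α⊡ (X₁ ⊚ Y₁) (X₂ ⊚ Y₂) (X₃ ⊚ Y₃)).hom =
      ((α⊡ X₁ X₂ X₃).hom ⊚ₘ (α⊡ Y₁ Y₂ Y₃).hom) ≫ ζ X₁ (X₂ ⊡ X₃) Y₁ (Y₂ ⊡ Y₃) ≫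
        (X₁ ⊚ Y₁) ◁⊡ ζ X₂ X₃ Y₂ Y₃
  ζ_left_I (X Y : C) :
    δ ▷⊚ (X ⊡ Y) ≫ ζ (unitI C) (unitI C) X Y ≫ ((λ⊚ X).hom ⊡ₘ (λ⊚ Y).hom) =
      (λ⊚ (X ⊡ Y)).hom
  ζ_right_I (X Y : C) :
    (X ⊡ Y) ◁⊚ δ ≫ ζ X Y (unitI C) (unitI C) ≫ ((ρ⊚ X).hom ⊡ₘ (ρ⊚ Y).hom) =
      (ρ⊚ (X ⊡ Y)).hom
  ζ_left_J (X Y : C) :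
    ζ (unitJ C) X (unitJ C) Y ≫ ϖ ▷⊡ (X ⊚ Y) ≫ (λ⊡ (X ⊚ Y)).hom =
      ((λ⊡ X).hom ⊚ₘ (λ⊡ Y).hom)
  ζ_right_J (X Y : C) :
    ζ X (unitJ C) Y (unitJ C) ≫ (X ⊚ Y) ◁⊡ ϖ ≫ (ρ⊡ (X ⊚ Y)).hom =
      ((ρ⊡ X).hom ⊚ₘ (ρ⊡ Y).hom)

section DuoidalCat

open Duoidal

variable (C : Type u) [Category.{v} C] [Duoidal C]

/-- The monoid `J` in the monoidal category `(C, ⊚, I)`. -/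
abbrev monJ : @MonObj C _ TwoMonoidal.circ (unitJ C) :=
  letI : MonoidalCategory C := TwoMonoidal.circ
  { one := τ
    mul := ϖ
    one_mul := unit_mul
    mul_one := mul_unit
    mul_assoc := mul_mul }

/-- The comonoid `I` in the monoidal category `(C, ⊡, J)`. -/
abbrev comonI : @ComonObj C _ TwoMonoidal.bul (unitI C) :=
  letI : MonoidalCategory C := TwoMonoidal.bul
  { counit := τ
    comul := δ
    counit_comul := counit_comul
    comul_counit := comul_counit
    comul_assoc := comul_comul }

/-- The category of right `I`-comodules in `(C, ⊡, J)`. -/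
abbrev ComodI : Type _ := @RightComod C _ TwoMonoidal.bul (unitI C) (comonI C)

/-- The category of right `J`-modules in `(C, ⊚, I)`. -/
abbrev ModJ : Type _ := @ModOver C _ TwoMonoidal.circ (unitJ C) (monJ C)

/-- The composite of the forgetful functor from `I`-comodules to `C` and of the free `J`-module
functor `(-) ⊚ J`. -/
def comodIToModJ : ComodI C ⥤ ModJ C :=
  @RightComod.forget C _ TwoMonoidal.bul (unitI C) (comonI C) ⋙
    @freeRightMod C _ TwoMonoidal.circ (unitJ C) (monJ C)

end DuoidalCat

/-! ## Weak bimonoids -/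

section Bimonoids

open Duoidal

variable {C : Type u} [Category.{v} C]

/-- A monoid for `⊚` and a comonoid for `⊡` on the same object `A`. -/
class MonComon [TwoMonoidal C] (A : C) where
  mon : @MonObj C _ TwoMonoidal.circ A
  comon : @ComonObj C _ TwoMonoidal.bul A

section

variable [TwoMonoidal C] (A : C) [MonComon A]

/-- The multiplication of `A`. -/
abbrev mu : A ⊚ A ⟶ A := @MonObj.mul C _ TwoMonoidal.circ A MonComon.mon

/-- The unit of `A`. -/
abbrev eta : unitI C ⟶ A := @MonObj.one C _ TwoMonoidal.circ A MonComon.mon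

/-- The comultiplication of `A`. -/
abbrev Del : A ⟶ A ⊡ A := @ComonObj.comul C _ TwoMonoidal.bul A MonComon.comon

/-- The counit of `A`. -/
abbrev eps : A ⟶ unitJ C := @ComonObj.counit C _ TwoMonoidal.bul A MonComon.comon

/-- The comultiplication applied to the unit. -/
abbrev DelEta : unitI C ⟶ A ⊡ A := eta A ≫ Del A

/-- The counit applied to the product. -/
abbrev epsMu : A ⊚ A ⟶ unitJ C := mu A ≫ eps A

end

/-- Weak bimonoids in a duoidal category: monoids for `⊚` which are comonoids for `⊡`, with
comultiplicative multiplication, and with weakly comultiplicative unit and weakly multiplicative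
counit. The axioms `mul_comul`, `rru`, `lru`, `lrc`, `llc` define right weak bimonoids, and
`mul_comul`, `rlu`, `llu`, `rrc`, `rlc` define left weak bimonoids. -/
class WeakBimonoid [Duoidal C] (A : C) extends MonComon A where
  mul_comul :
    mu A ≫ Del A = (Del A ⊚ₘ Del A) ≫ ζ A A A A ≫ (mu A ⊡ₘ mu A)
  rru :
    δ ≫ unitI C ◁⊡ DelEta A ≫ (α⊡ (unitI C) A A).inv ≫
      (ρ⊚ (unitI C ⊡ A)).inv ▷⊡ A ≫
      ((unitI C ⊡ A) ◁⊚ δ) ▷⊡ A ≫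
      ((unitI C ⊡ A) ◁⊚ (unitI C ◁⊡ DelEta A)) ▷⊡ A ≫
      ((unitI C ⊡ A) ◁⊚ (α⊡ (unitI C) A A).inv) ▷⊡ A ≫
      (ζ (unitI C) A (unitI C ⊡ A) A) ▷⊡ A ≫
      ((λ⊚ (unitI C ⊡ A)).hom ⊡ₘ mu A) ▷⊡ A =
    δ ≫ unitI C ◁⊡ eta A ≫ unitI C ◁⊡ Del A ≫ unitI C ◁⊡ (A ◁⊡ Del A) ≫
      (α⊡ (unitI C) A (A ⊡ A)).inv ≫ (α⊡ (unitI C ⊡ A) A A).inv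
  lru :
    δ ≫ DelEta A ▷⊡ unitI C ≫ (α⊡ A A (unitI C)).hom ≫
      A ◁⊡ (ρ⊚ (A ⊡ unitI C)).inv ≫
      A ◁⊡ ((A ⊡ unitI C) ◁⊚ δ) ≫
      A ◁⊡ ((A ⊡ unitI C) ◁⊚ (DelEta A ▷⊡ unitI C)) ≫
      A ◁⊡ ((A ⊡ unitI C) ◁⊚ (α⊡ A A (unitI C)).hom) ≫
      A ◁⊡ (ζ A (unitI C) A (A ⊡ unitI C)) ≫
      A ◁⊡ (mu A ⊡ₘ (λ⊚ (A ⊡ unitI C)).hom) =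
    δ ≫ eta A ▷⊡ unitI C ≫ Del A ▷⊡ unitI C ≫ (Del A ▷⊡ A) ▷⊡ unitI C ≫
      (α⊡ (A ⊡ A) A (unitI C)).hom ≫ (α⊡ A A (A ⊡ unitI C)).hom
  rlu :
    δ ≫ unitI C ◁⊡ DelEta A ≫ (α⊡ (unitI C) A A).inv ≫
      (λ⊚ (unitI C ⊡ A)).inv ▷⊡ A ≫
      (δ ▷⊚ (unitI C ⊡ A)) ▷⊡ A ≫
      ((unitI C ◁⊡ DelEta A) ▷⊚ (unitI C ⊡ A)) ▷⊡ A ≫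
      ((α⊡ (unitI C) A A).inv ▷⊚ (unitI C ⊡ A)) ▷⊡ A ≫
      (ζ (unitI C ⊡ A) A (unitI C) A) ▷⊡ A ≫
      ((ρ⊚ (unitI C ⊡ A)).hom ⊡ₘ mu A) ▷⊡ A =
    δ ≫ unitI C ◁⊡ eta A ≫ unitI C ◁⊡ Del A ≫ unitI C ◁⊡ (A ◁⊡ Del A) ≫
      (α⊡ (unitI C) A (A ⊡ A)).inv ≫ (α⊡ (unitI C ⊡ A) A A).inv
  llu :
    δ ≫ DelEta A ▷⊡ unitI C ≫ (α⊡ A A (unitI C)).hom ≫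
      A ◁⊡ (λ⊚ (A ⊡ unitI C)).inv ≫
      A ◁⊡ (δ ▷⊚ (A ⊡ unitI C)) ≫
      A ◁⊡ ((DelEta A ▷⊡ unitI C) ▷⊚ (A ⊡ unitI C)) ≫
      A ◁⊡ ((α⊡ A A (unitI C)).hom ▷⊚ (A ⊡ unitI C)) ≫
      A ◁⊡ (ζ A (A ⊡ unitI C) A (unitI C)) ≫
      A ◁⊡ (mu A ⊡ₘ (ρ⊚ (A ⊡ unitI C)).hom) =
    δ ≫ eta A ▷⊡ unitI C ≫ Del A ▷⊡ unitI C ≫ (Del A ▷⊡ A) ▷⊡ unitI C ≫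
      (α⊡ (A ⊡ A) A (unitI C)).hom ≫ (α⊡ A A (A ⊡ unitI C)).hom
  lrc :
    ((unitJ C ⊚ A) ◁⊚ Del A) ▷⊚ A ≫
      ((ρ⊡ (unitJ C ⊚ A)).inv ▷⊚ (A ⊡ A)) ▷⊚ A ≫
      (ζ (unitJ C ⊚ A) (unitJ C) A A) ▷⊚ A ≫
      ((α⊚ (unitJ C) A A).hom ▷⊡ (unitJ C ⊚ A)) ▷⊚ A ≫
      ((unitJ C ◁⊚ epsMu A) ▷⊡ (unitJ C ⊚ A)) ▷⊚ A ≫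
      (ϖ ▷⊡ (unitJ C ⊚ A)) ▷⊚ A ≫
      (λ⊡ (unitJ C ⊚ A)).hom ▷⊚ A ≫
      (α⊚ (unitJ C) A A).hom ≫ unitJ C ◁⊚ epsMu A ≫ ϖ =
    (α⊚ (unitJ C ⊚ A) A A).hom ≫ (unitJ C ⊚ A) ◁⊚ mu A ≫
      (α⊚ (unitJ C) A A).hom ≫ unitJ C ◁⊚ mu A ≫ unitJ C ◁⊚ eps A ≫ ϖ
  llc :
    ((unitJ C ⊚ A) ◁⊚ Del A) ▷⊚ A ≫
      ((λ⊡ (unitJ C ⊚ A)).inv ▷⊚ (A ⊡ A)) ▷⊚ A ≫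
      (ζ (unitJ C) (unitJ C ⊚ A) A A) ▷⊚ A ≫
      ((unitJ C ⊚ A) ◁⊡ (α⊚ (unitJ C) A A).hom) ▷⊚ A ≫
      ((unitJ C ⊚ A) ◁⊡ (unitJ C ◁⊚ epsMu A)) ▷⊚ A ≫
      ((unitJ C ⊚ A) ◁⊡ ϖ) ▷⊚ A ≫
      (ρ⊡ (unitJ C ⊚ A)).hom ▷⊚ A ≫
      (α⊚ (unitJ C) A A).hom ≫ unitJ C ◁⊚ epsMu A ≫ ϖ =
    (α⊚ (unitJ C ⊚ A) A A).hom ≫ (unitJ C ⊚ A) ◁⊚ mu A ≫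
      (α⊚ (unitJ C) A A).hom ≫ unitJ C ◁⊚ mu A ≫ unitJ C ◁⊚ eps A ≫ ϖ
  rrc :
    A ◁⊚ (Del A ▷⊚ (A ⊚ unitJ C)) ≫
      A ◁⊚ ((A ⊡ A) ◁⊚ (ρ⊡ (A ⊚ unitJ C)).inv) ≫
      A ◁⊚ (ζ A A (A ⊚ unitJ C) (unitJ C)) ≫
      A ◁⊚ ((α⊚ A A (unitJ C)).inv ▷⊡ (A ⊚ unitJ C)) ≫
      A ◁⊚ ((epsMu A ▷⊚ unitJ C) ▷⊡ (A ⊚ unitJ C)) ≫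
      A ◁⊚ (ϖ ▷⊡ (A ⊚ unitJ C)) ≫
      A ◁⊚ (λ⊡ (A ⊚ unitJ C)).hom ≫
      (α⊚ A A (unitJ C)).inv ≫ epsMu A ▷⊚ unitJ C ≫ ϖ =
    (α⊚ A A (A ⊚ unitJ C)).inv ≫ mu A ▷⊚ (A ⊚ unitJ C) ≫
      (α⊚ A A (unitJ C)).inv ≫ mu A ▷⊚ unitJ C ≫ eps A ▷⊚ unitJ C ≫ ϖ
  rlc :
    A ◁⊚ (Del A ▷⊚ (A ⊚ unitJ C)) ≫
      A ◁⊚ ((A ⊡ A) ◁⊚ (λ⊡ (A ⊚ unitJ C)).inv) ≫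
      A ◁⊚ (ζ A A (unitJ C) (A ⊚ unitJ C)) ≫
      A ◁⊚ ((A ⊚ unitJ C) ◁⊡ (α⊚ A A (unitJ C)).inv) ≫
      A ◁⊚ ((A ⊚ unitJ C) ◁⊡ (epsMu A ▷⊚ unitJ C)) ≫
      A ◁⊚ ((A ⊚ unitJ C) ◁⊡ ϖ) ≫
      A ◁⊚ (ρ⊡ (A ⊚ unitJ C)).hom ≫
      (α⊚ A A (unitJ C)).inv ≫ epsMu A ▷⊚ unitJ C ≫ ϖ =
    (α⊚ A A (A ⊚ unitJ C)).inv ≫ mu A ▷⊚ (A ⊚ unitJ C) ≫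
      (α⊚ A A (unitJ C)).inv ≫ mu A ▷⊚ unitJ C ≫ eps A ▷⊚ unitJ C ≫ ϖ

/-! ### The base object -/

variable [Duoidal C]

/-- The endomorphism of `A ⊡ I` whose splitting is the base object `L` of `A`. For a weak bialgebra
it is the target map `a ↦ ε(1₁ a) 1₂`. -/
def sqcapL (A : C) [MonComon A] : A ⊡ unitI C ⟶ A ⊡ unitI C :=
  (λ⊚ (A ⊡ unitI C)).inv ≫
    δ ▷⊚ (A ⊡ unitI C) ≫
    (DelEta A ▷⊡ unitI C) ▷⊚ (A ⊡ unitI C) ≫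
    (α⊡ A A (unitI C)).hom ▷⊚ (A ⊡ unitI C) ≫
    ζ A (A ⊡ unitI C) A (unitI C) ≫
    (epsMu A ⊡ₘ (ρ⊚ (A ⊡ unitI C)).hom) ≫
    (λ⊡ (A ⊡ unitI C)).hom

/-- A choice of the base object `L`: an object `L` through which `sqcapL A` splits. -/
structure BaseObject (A : C) [MonComon A] where
  L : C
  ι : L ⟶ A ⊡ unitI C
  π : A ⊡ unitI C ⟶ L
  ι_π : ι ≫ π = 𝟙 L
  π_ι : π ≫ ι = sqcapL A

namespace BaseObject

variable {A : C} [MonComon A] (B : BaseObject A)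

/-- The multiplication of `L` for `⊚`. -/
def mul : B.L ⊚ B.L ⟶ B.L :=
  (B.ι ⊚ₘ B.ι) ≫ ζ A (unitI C) A (unitI C) ≫ (mu A ⊡ₘ (λ⊚ (unitI C)).hom) ≫ B.π

/-- The unit of `L` for `⊚`. -/
def one : unitI C ⟶ B.L :=
  δ ≫ eta A ▷⊡ unitI C ≫ B.π

/-- The right `I`-coaction on `L`. -/
def coact : B.L ⟶ B.L ⊡ unitI C :=
  B.ι ≫ A ◁⊡ δ ≫ (α⊡ A (unitI C) (unitI C)).inv ≫ B.π ▷⊡ unitI C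

/-- The morphism of monoids from `L` to `A`. -/
def ω : B.L ⟶ A :=
  B.ι ≫ A ◁⊡ τ ≫ (ρ⊡ A).hom

/-- The category of right `L`-modules in `(C, ⊚, I)`. -/
abbrev ModL : Type _ := @RightMod C _ TwoMonoidal.circ B.L B.mul B.one

/-- Right `L`-modules in the category of right `I`-comodules: right `I`-comodules with a right
`L`-action which is a morphism of `I`-comodules, where the coaction on `X ⊚ L` is the diagonal
one, `(coact ⊚ₘ coact) ≫ ζ` followed by the identification of `I ⊚ I` with `I`. -/
structure ModLComodI where
  X : C
  act : X ⊚ B.L ⟶ X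
  act_one : X ◁⊚ B.one ≫ act = (ρ⊚ X).hom
  act_act : act ▷⊚ B.L ≫ act = (α⊚ X B.L B.L).hom ≫ X ◁⊚ B.mul ≫ act
  coact : X ⟶ X ⊡ unitI C
  coact_counit : coact ≫ X ◁⊡ τ = (ρ⊡ X).inv
  coact_coact : coact ≫ coact ▷⊡ unitI C =
    coact ≫ X ◁⊡ δ ≫ (α⊡ X (unitI C) (unitI C)).inv
  act_coact : act ≫ coact =
    (coact ⊚ₘ B.coact) ≫ ζ X (unitI C) B.L (unitI C) ≫ (act ⊡ₘ (λ⊚ (unitI C)).hom)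

namespace ModLComodI

variable {B}

/-- Morphisms which are compatible with both the action and the coaction. -/
@[ext]
structure Hom (P Q : B.ModLComodI) where
  hom : P.X ⟶ Q.X
  linear : P.act ≫ hom = hom ▷⊚ B.L ≫ Q.act
  colinear : P.coact ≫ hom ▷⊡ unitI C = hom ≫ Q.coact

instance : Category (B.ModLComodI) where
  Hom P Q := Hom P Q
  id P := ⟨𝟙 P.X, by
      rw [@MonoidalCategory.id_whiskerRight C _ TwoMonoidal.circ, Category.comp_id,
        Category.id_comp], by
      rw [@MonoidalCategory.id_whiskerRight C _ TwoMonoidal.bul, Category.comp_id,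
        Category.id_comp]⟩
  comp f g := ⟨f.hom ≫ g.hom, by
      rw [@MonoidalCategory.comp_whiskerRight C _ TwoMonoidal.circ, ← Category.assoc, f.linear,
        Category.assoc, g.linear, Category.assoc], by
      rw [@MonoidalCategory.comp_whiskerRight C _ TwoMonoidal.bul, ← Category.assoc, f.colinear,
        Category.assoc, g.colinear, Category.assoc]⟩
  id_comp _ := Hom.ext (Category.id_comp _)
  comp_id _ := Hom.ext (Category.comp_id _)
  assoc _ _ _ := Hom.ext (Category.assoc _ _ _)

end ModLComodI

/-- The functor forgetting the `I`-coaction. -/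
def forgetCoact : B.ModLComodI ⥤ B.ModL where
  obj P := @RightMod.mk C _ TwoMonoidal.circ B.L B.mul B.one P.X P.act P.act_one P.act_act
  map f := @RightMod.Hom.mk C _ TwoMonoidal.circ B.L B.mul B.one _ _ f.hom f.linear
  map_id _ := rfl
  map_comp _ _ := rfl

/-- A tensor product of the right `L`-module `P` with `A` over `L` in `(C, ⊚, I)`. -/
abbrev TensorA (P : B.ModL) : Type _ :=
  @RelTensor C _ TwoMonoidal.circ B.L B.mul B.one A MonComon.mon B.ω P

/-- The Kleisli category of the monad given by tensoring with `A` over `L` on the category of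
right `L`-modules. -/
abbrev KleisliA (T : ∀ P : B.ModL, B.TensorA P) : Type _ :=
  @KleisliCat C _ TwoMonoidal.circ B.L B.mul B.one A MonComon.mon B.ω T

/-- The functor which tensors with `A` over `L`, from the category of right `L`-modules in the
category of `I`-comodules to the Kleisli category. -/
noncomputable def tensorFunctor (T : ∀ P : B.ModL, B.TensorA P) :
    B.ModLComodI ⥤ B.KleisliA T :=
  B.forgetCoact ⋙ @extendScalars C _ TwoMonoidal.circ B.L B.mul B.one A MonComon.mon B.ω T

end BaseObject

end Bimonoids

end WeakBim

/-! The heart is `isSeparable_tensorFunctor`: under the hypotheses the functor $\widetilde Y$ is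
itself separable. A retraction of its action on morphisms carries the inverse of an image, or the
backward morphism of a contractible image pair, to one for the original data. Hence isomorphisms and
contractibility are reflected. Idempotents split in $\mathcal M^I_L$ because they split in $\mathcal
M$, and splitting the idempotent of a contractible pair yields its contractible equalizer.

The retraction turns an $A$-linear $P\circ_LA\to Q\circ_LA$ into a morphism $P\to Q$ in three
stages. The left $L$-linear map $a\mapsto\varepsilon(1_1a)1_2$ from $A$ to $L\circ J$ (`toFree`)
induces $Q\circ_LA\to Q\circ J$, and so produces a $J$-linear map $P\circ J\to Q\circ J$
(`exists_retraction_freeRightMod`). The assumed separability turns this into an $I$-colinear $f:P\to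
Q$. Finally $f$ is averaged to $x\mapsto f(xc_1)c_2$ over a Casimir element $c$ of $L$, with $lc=cl$
and $c_1c_2=1$. The average is $L$-linear, and still colinear because $c$ and the actions are
(`colinear_insert`). The same $c$ makes the coequalizer defining $P\circ_LA$ split, so it exists and
is absolute (`nonempty_relTensor`).

The element $c$ is found by weak bialgebra calculus in the single monoidal category $(\mathcal
M,\circ)$, where $T=A\bullet-$ is a `WeakBicomonad`. Below, Sweedler indices refer to `d`, the
counit $\varepsilon$ to `e`, $1_1\otimes1_2$ to `u`, and $\varepsilon_t(x)=\varepsilon(1_1x)1_2$. -/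

namespace WeakBim

/-! ### Weak bialgebra calculus for a weak bicomonad. -/

section Abstract

open MonoidalCategory

/-- A lax monoidal functor which is also a comonad, whose comultiplication is compatible with the
binary part of the lax monoidal structure, and whose unit and counit are weakly compatible with
the rest of the structure. -/
structure WeakBicomonad (V : Type u) [Category.{v} V] [MonoidalCategory V] where
  T : V ⥤ V
  η : 𝟙_ V ⟶ T.obj (𝟙_ V)
  m (X Y : V) : T.obj X ⊗ T.obj Y ⟶ T.obj (X ⊗ Y)
  d (X : V) : T.obj X ⟶ T.obj (T.obj X)
  e (X : V) : T.obj X ⟶ X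
  m_left {X X' : V} (f : X ⟶ X') (Y : V) :
    T.map f ▷ T.obj Y ≫ m X' Y = m X Y ≫ T.map (f ▷ Y)
  m_right (X : V) {Y Y' : V} (f : Y ⟶ Y') :
    T.obj X ◁ T.map f ≫ m X Y' = m X Y ≫ T.map (X ◁ f)
  m_assoc (X Y Z : V) :
    m X Y ▷ T.obj Z ≫ m (X ⊗ Y) Z ≫ T.map (α_ X Y Z).hom =
      (α_ _ _ _).hom ≫ T.obj X ◁ m Y Z ≫ m X (Y ⊗ Z)
  η_m (X : V) : η ▷ T.obj X ≫ m (𝟙_ V) X ≫ T.map (λ_ X).hom = (λ_ (T.obj X)).hom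
  m_η (X : V) : T.obj X ◁ η ≫ m X (𝟙_ V) ≫ T.map (ρ_ X).hom = (ρ_ (T.obj X)).hom
  d_nat {X Y : V} (f : X ⟶ Y) : T.map f ≫ d Y = d X ≫ T.map (T.map f)
  e_nat {X Y : V} (f : X ⟶ Y) : T.map f ≫ e Y = e X ≫ f
  d_e (X : V) : d X ≫ e (T.obj X) = 𝟙 _
  d_map_e (X : V) : d X ≫ T.map (e X) = 𝟙 _
  d_d (X : V) : d X ≫ d (T.obj X) = d X ≫ T.map (d X)
  m_d (X Y : V) :
    m X Y ≫ d (X ⊗ Y) = (d X ⊗ₘ d Y) ≫ m (T.obj X) (T.obj Y) ≫ T.map (m X Y)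
  unit_right :
    η ≫ d (𝟙_ V) ≫ T.map ((ρ_ (T.obj (𝟙_ V))).inv ≫ T.obj (𝟙_ V) ◁ (η ≫ d (𝟙_ V)) ≫
      m (𝟙_ V) (T.obj (𝟙_ V)) ≫ T.map (λ_ (T.obj (𝟙_ V))).hom) =
    η ≫ d (𝟙_ V) ≫ T.map (d (𝟙_ V))
  unit_left :
    η ≫ d (𝟙_ V) ≫ T.map ((λ_ (T.obj (𝟙_ V))).inv ≫ (η ≫ d (𝟙_ V)) ▷ T.obj (𝟙_ V) ≫
      m (T.obj (𝟙_ V)) (𝟙_ V) ≫ T.map (ρ_ (T.obj (𝟙_ V))).hom) =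
    η ≫ d (𝟙_ V) ≫ T.map (d (𝟙_ V))
  counit_left (X Y Z : V) :
    (T.obj X ◁ d Y ≫ m X (T.obj Y) ≫ e (X ⊗ T.obj Y)) ▷ T.obj Z ≫ (α_ _ _ _).hom ≫
      X ◁ (m Y Z ≫ e (Y ⊗ Z)) =
    (α_ _ _ _).hom ≫ T.obj X ◁ m Y Z ≫ m X (Y ⊗ Z) ≫ e (X ⊗ Y ⊗ Z)
  counit_right (X Y Z : V) :
    T.obj X ◁ (d Y ▷ T.obj Z ≫ m (T.obj Y) Z ≫ e (T.obj Y ⊗ Z)) ≫ (α_ _ _ _).inv ≫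
      (m X Y ≫ e (X ⊗ Y)) ▷ Z ≫ (α_ _ _ _).hom =
    T.obj X ◁ m Y Z ≫ m X (Y ⊗ Z) ≫ e (X ⊗ Y ⊗ Z)

namespace WeakBicomonad

variable {V : Type u} [Category.{v} V] [MonoidalCategory V] (S : WeakBicomonad V)

/-- The counit applied to a product. -/
def q (X Y : V) : S.T.obj X ⊗ S.T.obj Y ⟶ X ⊗ Y := S.m X Y ≫ S.e (X ⊗ Y)

/-- `x ⊗ y ↦ x₂ ⊗ ε(x₁ y)`. -/
def w (X Y : V) : S.T.obj X ⊗ S.T.obj Y ⟶ S.T.obj X ⊗ Y :=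
  S.d X ▷ S.T.obj Y ≫ S.q (S.T.obj X) Y

/-- The comultiplication applied to the unit. -/
def u : 𝟙_ V ⟶ S.T.obj (S.T.obj (𝟙_ V)) := S.η ≫ S.d (𝟙_ V)

/-- `x ↦ 1₁ x ⊗ 1₂`. -/
def p (X : V) : S.T.obj X ⟶ S.T.obj (S.T.obj (𝟙_ V) ⊗ X) :=
  (λ_ (S.T.obj X)).inv ≫ S.u ▷ S.T.obj X ≫ S.m (S.T.obj (𝟙_ V)) X

/-- `x ↦ ε(1₁ x) 1₂`. -/
def κ (X : V) : S.T.obj X ⟶ S.T.obj (𝟙_ V) ⊗ X :=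
  (λ_ (S.T.obj X)).inv ≫ S.u ▷ S.T.obj X ≫ S.q (S.T.obj (𝟙_ V)) X

/-- The idempotent `x ↦ ε(1₁ x) 1₂`. -/
def sq : S.T.obj (𝟙_ V) ⟶ S.T.obj (𝟙_ V) := S.κ (𝟙_ V) ≫ (ρ_ _).hom

/-- The left action of `T I` on `T X`. -/
def lact (X : V) : S.T.obj (𝟙_ V) ⊗ S.T.obj X ⟶ S.T.obj X :=
  S.m (𝟙_ V) X ≫ S.T.map (λ_ X).hom

/-- The right action of `T I` on `T X`. -/
def ract (X : V) : S.T.obj X ⊗ S.T.obj (𝟙_ V) ⟶ S.T.obj X :=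
  S.m X (𝟙_ V) ≫ S.T.map (ρ_ X).hom

/-- The Casimir element `ε(1₁' 1₁) 1₂' ⊗ 1₂`. -/
def cas : 𝟙_ V ⟶ S.T.obj (𝟙_ V) ⊗ S.T.obj (𝟙_ V) := S.u ≫ S.κ (S.T.obj (𝟙_ V))

theorem lact_unit : S.lact (𝟙_ V) = S.ract (𝟙_ V) := by
  rw [lact, ract, unitors_equal]

theorem q_left {X X' : V} (f : X ⟶ X') (Y : V) :
    S.T.map f ▷ S.T.obj Y ≫ S.q X' Y = S.q X Y ≫ f ▷ Y := by
  rw [q, q, reassoc_of% S.m_left, S.e_nat, Category.assoc]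

theorem q_right (X : V) {Y Y' : V} (f : Y ⟶ Y') :
    S.T.obj X ◁ S.T.map f ≫ S.q X Y' = S.q X Y ≫ X ◁ f := by
  rw [q, q, reassoc_of% S.m_right, S.e_nat, Category.assoc]

theorem κ_nat {X Y : V} (f : X ⟶ Y) : S.T.map f ≫ S.κ Y = S.κ X ≫ S.T.obj (𝟙_ V) ◁ f := by
  simp only [κ, Category.assoc]
  rw [← S.q_right, ← whisker_exchange_assoc, leftUnitor_inv_naturality_assoc]

theorem u_map_d : S.u ≫ S.T.map (S.d (𝟙_ V)) = S.u ≫ S.d _ := by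
  rw [u, Category.assoc, Category.assoc, S.d_d]

theorem u_map_p :
    S.u ≫ S.T.map (S.p (𝟙_ V) ≫ S.T.map (ρ_ _).hom) = S.u ≫ S.T.map (S.d (𝟙_ V)) := by
  simpa only [u, p, Category.assoc] using S.unit_left

theorem u_map_ract :
    S.u ≫ S.T.map ((ρ_ _).inv ≫ S.T.obj (𝟙_ V) ◁ S.u ≫ S.lact _) =
      S.u ≫ S.T.map (S.d (𝟙_ V)) := by
  simpa only [u, lact, Category.assoc] using S.unit_right

theorem p_e (X : V) : S.p X ≫ S.e _ = S.κ X := by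
  simp only [p, κ, q, Category.assoc]

/-- $1_1\otimes\varepsilon_t(1_2)=1_1\otimes1_2$: by the left unit axiom
$1_1\otimes1_1'1_2\otimes1_2'$ is $1_1\otimes1_2\otimes1_3$, and the counit removes the middle
factor. -/
theorem u_map_sq : S.u ≫ S.T.map S.sq = S.u := by
  have h : S.sq = (S.p (𝟙_ V) ≫ S.T.map (ρ_ _).hom) ≫ S.e _ := by
    rw [Category.assoc, S.e_nat, reassoc_of% S.p_e, sq]
  rw [h, Functor.map_comp, reassoc_of% S.u_map_p, ← Functor.map_comp, S.d_e,
    CategoryTheory.Functor.map_id, Category.comp_id]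

theorem κ_map {W : V} (f g : S.T.obj (𝟙_ V) ⟶ W) (h : S.u ≫ S.T.map f = S.u ≫ S.T.map g) (X : V) :
    S.κ X ≫ f ▷ X = S.κ X ≫ g ▷ X := by
  simp only [κ, Category.assoc, ← S.q_left, ← comp_whiskerRight_assoc, h]

theorem κ_sq (X : V) : S.κ X ≫ S.sq ▷ X = S.κ X := by
  rw [S.κ_map S.sq (𝟙 _) (by rw [S.u_map_sq, CategoryTheory.Functor.map_id, Category.comp_id]),
    id_whiskerRight, Category.comp_id]

/-- The values of `sq` are built from the second leg of `u`, so identities on the base need to be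
checked on that leg only. This is how the unit axioms are applied to elements of the base. -/
theorem sq_map {W : V} (f g : S.T.obj (𝟙_ V) ⟶ W) (h : S.u ≫ S.T.map f = S.u ≫ S.T.map g) :
    S.sq ≫ f = S.sq ≫ g := by
  rw [sq, Category.assoc, Category.assoc, ← rightUnitor_naturality, ← rightUnitor_naturality,
    reassoc_of% S.κ_map f g h]

theorem sq_sq : S.sq ≫ S.sq = S.sq := by
  rw [S.sq_map S.sq (𝟙 _) (by rw [S.u_map_sq, CategoryTheory.Functor.map_id, Category.comp_id]), Category.comp_id]

theorem ract_η (X : V) : (ρ_ (S.T.obj X)).inv ≫ S.T.obj X ◁ S.η ≫ S.ract X = 𝟙 _ := by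
  rw [ract, S.m_η, Iso.inv_hom_id]

theorem lact_η (X : V) : (λ_ (S.T.obj X)).inv ≫ S.η ▷ S.T.obj X ≫ S.lact X = 𝟙 _ := by
  rw [lact, S.η_m, Iso.inv_hom_id]

theorem η_sq : S.η ≫ S.sq = S.η := by
  have h : S.T.obj (S.T.obj (𝟙_ V)) ◁ S.η ≫ S.q (S.T.obj (𝟙_ V)) (𝟙_ V) ≫ (ρ_ _).hom =
      (ρ_ _).hom ≫ S.e _ := by
    rw [← S.m_η (S.T.obj (𝟙_ V)), q, Category.assoc, Category.assoc, Category.assoc, S.e_nat]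
  rw [sq, κ]
  simp only [Category.assoc]
  rw [leftUnitor_inv_naturality_assoc, whisker_exchange_assoc, h, unitors_inv_equal,
    ← rightUnitor_inv_naturality_assoc, Iso.inv_hom_id_assoc, u, Category.assoc, S.d_e,
    Category.comp_id]

theorem ract_d (X : V) :
    S.ract X ≫ S.d X = (S.d X ⊗ₘ S.d (𝟙_ V)) ≫ S.m _ _ ≫ S.T.map (S.ract X) := by
  rw [ract, Category.assoc, S.d_nat, reassoc_of% S.m_d, Functor.map_comp]

/-- $xy=\varepsilon(x_1y_1)\,x_2y_2$: comultiply the product, then apply the counit to the first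
leg. -/
theorem m_eq (X Y : V) : S.m X Y = (S.d X ⊗ₘ S.d Y) ≫ S.q _ _ ≫ S.m X Y := by
  have h := S.m_d X Y =≫ S.e _
  rw [Category.assoc, S.d_e, Category.comp_id, Category.assoc, Category.assoc, S.e_nat] at h
  rw [q, Category.assoc]
  exact h

/-- $x_11_1\otimes x_21_2=x_1\otimes x_2$: comultiply $x\cdot1=x$. -/
theorem d_ract_u (X : V) :
    S.d X ≫ (ρ_ _).inv ≫ S.T.obj (S.T.obj X) ◁ S.u ≫ S.m _ _ ≫ S.T.map (S.ract X) = S.d X := by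
  have h := S.ract_η X =≫ S.d X
  rw [Category.id_comp, Category.assoc, Category.assoc, S.ract_d, tensorHom_def'] at h
  refine Eq.trans ?_ h
  simp only [u, MonoidalCategory.whiskerLeft_comp, Category.assoc,
    rightUnitor_inv_naturality_assoc, whisker_exchange_assoc]

theorem κ_d (X : V) :
    S.κ X ≫ S.d (𝟙_ V) ▷ X = (λ_ _).inv ≫ S.u ▷ S.T.obj X ≫ S.w _ X := by
  simp only [κ, w, Category.assoc, ← S.q_left, ← comp_whiskerRight_assoc, S.u_map_d]

theorem p_lact (X : V) :
    S.lact X ≫ S.p X = S.p (𝟙_ V) ▷ S.T.obj X ≫ S.m _ X ≫ S.T.map ((ρ_ _).hom ▷ X) := by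
  have h := S.m_assoc (S.T.obj (𝟙_ V)) (𝟙_ V) X
  simp only [lact, p, comp_whiskerRight, Category.assoc]
  have h1 : S.T.map ((ρ_ (S.T.obj (𝟙_ V))).hom ▷ X) =
      S.T.map (α_ _ _ _).hom ≫ S.T.map (S.T.obj (𝟙_ V) ◁ (λ_ X).hom) := by
    rw [← Functor.map_comp, triangle]
  rw [h1, reassoc_of% h, ← S.m_right, leftUnitor_inv_naturality_assoc]
  simp only [whisker_exchange_assoc, leftUnitor_inv_naturality_assoc]
  monoidal

/-- `x ε_t(y) = ε(x₁ y) x₂`. -/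
theorem w_eq (X Y : V) :
    S.w X Y = S.T.obj X ◁ S.κ Y ≫ (α_ _ _ _).inv ≫ S.ract X ▷ Y := by
  -- The computation is
  -- $x\,\varepsilon_t(y)=\varepsilon(1_1y)\,\varepsilon(x_11_2)\,x_21_3=\varepsilon(x_11_1y)\,x_21_2=\varepsilon(x_1y)\,x_2$,
  -- by `m_eq`, `counit_right` and `d_ract_u` in turn.
  have hm : S.ract X = (S.d X ⊗ₘ S.d (𝟙_ V)) ≫ S.q _ _ ≫ S.ract X := by
    conv_lhs => rw [ract, S.m_eq]
    simp only [ract, Category.assoc]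
  have hq : S.T.obj (S.T.obj X) ◁ S.m (S.T.obj (𝟙_ V)) Y ≫ S.q _ _ ≫ (α_ _ _ _).inv =
      (α_ _ _ _).inv ≫ S.m _ _ ▷ _ ≫ S.q _ _ := by
    rw [Iso.eq_inv_comp, q, q, Category.assoc, ← S.e_nat, ← reassoc_of% S.m_assoc,
      ← Functor.map_comp_assoc, Iso.hom_inv_id, CategoryTheory.Functor.map_id, Category.id_comp]
  have hc : S.T.obj (S.T.obj X) ◁ S.w (S.T.obj (𝟙_ V)) Y ≫ (α_ _ _ _).inv ≫ S.q _ _ ▷ Y =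
      S.T.obj (S.T.obj X) ◁ S.m (S.T.obj (𝟙_ V)) Y ≫ S.q _ _ ≫ (α_ _ _ _).inv := by
    have := S.counit_right (S.T.obj X) (S.T.obj (𝟙_ V)) Y =≫ (α_ _ _ _).inv
    simp only [Category.assoc, Iso.hom_inv_id, Category.comp_id] at this
    simpa only [w, q, Category.assoc] using this
  have h1 : S.T.obj X ◁ S.κ Y ≫ (α_ _ _ _).inv ≫ (S.d X ⊗ₘ S.d (𝟙_ V)) ▷ Y =
      S.d X ▷ _ ≫ S.T.obj (S.T.obj X) ◁ ((λ_ _).inv ≫ S.u ▷ S.T.obj Y) ≫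
        S.T.obj (S.T.obj X) ◁ S.w _ Y ≫ (α_ _ _ _).inv := by
    have := S.κ_d Y
    rw [← MonoidalCategory.whiskerLeft_comp_assoc, Category.assoc, ← this,
      ← whisker_exchange_assoc, tensorHom_def']
    simp
  rw [hm, comp_whiskerRight, reassoc_of% h1, comp_whiskerRight, reassoc_of% hc,
    reassoc_of% hq, ← S.q_left]
  have h2 : S.T.obj (S.T.obj X) ◁ ((λ_ _).inv ≫ S.u ▷ S.T.obj Y) ≫ (α_ _ _ _).inv =
      ((ρ_ _).inv ≫ S.T.obj (S.T.obj X) ◁ S.u) ▷ _ := by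
    simp
  rw [reassoc_of% h2]
  simp only [← comp_whiskerRight_assoc, Category.assoc]
  rw [S.d_ract_u, w]

/-- $\varepsilon_t(la)=l\,\varepsilon_t(a)$ for $l$ in the image of `sq`. There the left unit axiom
gives $1_1l\otimes1_2=l_1\otimes l_2$, so the left side is $\varepsilon(l_1a)\,l_2$, which is the
right side by `w_eq`. -/
theorem sq_lact_κ (X : V) :
    S.sq ▷ S.T.obj X ≫ S.lact X ≫ S.κ X =
      S.sq ▷ S.T.obj X ≫ S.T.obj (𝟙_ V) ◁ S.κ X ≫ (α_ _ _ _).inv ≫ S.lact (𝟙_ V) ▷ X := by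
  rw [lact_unit, ← S.w_eq, w, ← S.p_e, reassoc_of% S.p_lact, S.e_nat, ← Category.assoc (S.m _ _),
    ← q, ← S.q_left]
  simp only [← comp_whiskerRight_assoc]
  rw [S.sq_map _ _ S.u_map_p]

/-- Together with `cas_sq` this gives centrality of `cas` over the base: for $l=\varepsilon_t(x)$
both $lc$ and $cl$ equal $\varepsilon(1_1'1_1x)\,1_2'\otimes1_2$. -/
theorem sq_cas :
    S.sq ≫ (ρ_ _).inv ≫ S.T.obj (𝟙_ V) ◁ S.cas ≫ (α_ _ _ _).inv ≫ S.ract _ ▷ _ =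
      S.p _ ≫ S.T.map (ρ_ _).hom ≫ S.κ _ := by
  -- For $l$ in the image of `sq`,
  -- $l\,\varepsilon_t(1_1)\otimes1_2=\varepsilon_t(l1_1)\otimes1_2=\varepsilon_t(l_1)\otimes l_2$;
  -- the last equality is the right unit axiom.
  have h1 : S.sq ≫ (ρ_ _).inv ≫ S.T.obj (𝟙_ V) ◁ S.cas ≫ (α_ _ _ _).inv ≫ S.ract _ ▷ _ =
      S.sq ≫ S.d _ ≫ S.κ _ := by
    rw [cas, ← lact_unit, MonoidalCategory.whiskerLeft_comp, Category.assoc,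
      rightUnitor_inv_naturality_assoc, ← whisker_exchange_assoc, ← S.sq_lact_κ,
      whisker_exchange_assoc, ← rightUnitor_inv_naturality_assoc]
    have := S.sq_map _ _ S.u_map_ract
    simp only [← Category.assoc] at this ⊢
    rw [this]
  -- Here `counit_right` contracts $\varepsilon(1_1'1_2)\,\varepsilon(1_1x)$ to
  -- $\varepsilon(1_1'1_1x)$.
  have h2 : S.κ (𝟙_ V) ≫ S.d _ ▷ _ ≫ S.κ (S.T.obj (𝟙_ V)) ▷ 𝟙_ V ≫ (α_ _ _ _).hom =
      S.p (𝟙_ V) ≫ S.κ _ := by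
    have h := S.counit_right (S.T.obj (𝟙_ V)) (S.T.obj (𝟙_ V)) (𝟙_ V)
    rw [reassoc_of% S.κ_d]
    have h3 : S.κ (S.T.obj (𝟙_ V)) ▷ 𝟙_ V = (λ_ _).inv ≫ S.u ▷ _ ≫ (α_ _ _ _).inv ≫
        S.q _ _ ▷ 𝟙_ V := by
      simp only [κ, comp_whiskerRight]
      monoidal
    have h4 : S.w (S.T.obj (𝟙_ V)) (𝟙_ V) ≫ S.κ (S.T.obj (𝟙_ V)) ▷ 𝟙_ V ≫ (α_ _ _ _).hom =
        S.m _ _ ≫ S.κ _ := by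
      rw [h3, κ]
      simp only [Category.assoc]
      rw [leftUnitor_inv_naturality_assoc, leftUnitor_inv_naturality_assoc,
        whisker_exchange_assoc, whisker_exchange_assoc]
      simp only [w, q] at h ⊢
      rw [h]
    rw [h4, p, Category.assoc, Category.assoc]
  rw [h1, sq, Category.assoc, ← rightUnitor_naturality_assoc, ← rightUnitor_naturality,
    S.κ_nat, ← reassoc_of% h2]
  simp

/-- By `w_eq`, $c_2\,\varepsilon_t(x)=\varepsilon(c_{2,1}x)\,c_{2,2}$. Then `counit_left` contracts
$\varepsilon(1_1'1_1)\,\varepsilon(1_2x)$ to $\varepsilon(1_1'1_1x)$. -/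
theorem cas_sq :
    S.sq ≫ (λ_ _).inv ≫ S.cas ▷ S.T.obj (𝟙_ V) ≫ (α_ _ _ _).hom ≫ _ ◁ S.ract _ =
      S.p _ ≫ S.T.map (ρ_ _).hom ≫ S.κ _ := by
  have h1 : S.T.obj (𝟙_ V) ◁ S.sq ≫ S.ract (𝟙_ V) = S.w _ _ ≫ (ρ_ _).hom := by
    rw [S.w_eq, sq, Category.assoc, Category.assoc, rightUnitor_naturality]
    simp
  have h2 : S.cas ≫ S.T.obj (𝟙_ V) ◁ S.d _ = S.u ≫ (λ_ _).inv ≫ S.u ▷ _ ≫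
      S.T.obj (S.T.obj (𝟙_ V)) ◁ S.d _ ≫ S.q _ _ := by
    rw [cas, Category.assoc, ← S.κ_nat, reassoc_of% S.u_map_d, κ, leftUnitor_inv_naturality_assoc,
      whisker_exchange_assoc]
  have h3 := S.counit_left (S.T.obj (𝟙_ V)) (S.T.obj (𝟙_ V)) (𝟙_ V)
  rw [leftUnitor_inv_naturality_assoc, whisker_exchange_assoc, associator_naturality_right_assoc,
    ← MonoidalCategory.whiskerLeft_comp, h1, w, Category.assoc, MonoidalCategory.whiskerLeft_comp,
    ← associator_naturality_middle_assoc, ← comp_whiskerRight_assoc, h2]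
  simp only [comp_whiskerRight, MonoidalCategory.whiskerLeft_comp, Category.assoc, q] at h3 ⊢
  rw [reassoc_of% h3, p, κ, q]
  simp only [Category.assoc]
  rw [leftUnitor_inv_naturality_assoc, leftUnitor_inv_naturality_assoc, whisker_exchange_assoc,
    whisker_exchange_assoc]
  rw [reassoc_of% S.m_right, S.e_nat]
  simp only [← Category.assoc]
  congr 4
  monoidal

/-- $\varepsilon_t(x_1)\,x_2=\varepsilon(1_1x_1)\,1_2x_2=1\cdot x$ by `m_eq`. At $x=1$ it says that
the two legs of `cas` multiply to $1$. -/
theorem d_κ_lact (X : V) : S.d X ≫ S.κ _ ≫ S.lact X = 𝟙 _ := by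
  have h := S.m_eq (𝟙_ V) X
  rw [κ, lact]
  simp only [Category.assoc]
  rw [leftUnitor_inv_naturality_assoc, u, comp_whiskerRight_assoc, whisker_exchange_assoc,
    ← S.lact_η X, lact]
  conv_rhs => rw [h]
  simp only [tensorHom_def', Category.assoc]

theorem cas_mul : S.cas ≫ S.ract _ = S.η := by
  rw [cas, u, Category.assoc, Category.assoc, ← S.lact_unit, S.d_κ_lact, Category.comp_id]

theorem cas_sq_left : S.cas ≫ S.sq ▷ _ = S.cas := by
  rw [cas, Category.assoc, S.κ_sq]

theorem cas_sq_right : S.cas ≫ _ ◁ S.sq = S.cas := by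
  rw [cas, Category.assoc, ← S.κ_nat, reassoc_of% S.u_map_sq]

end WeakBicomonad
end Abstract

/-! ### Averaging and relative tensor products from a Casimir element. -/

section Casimir

open MonoidalCategory Limits

variable {V : Type u} [Category.{v} V] [MonoidalCategory V]

/-- A Casimir element of `L`, whose product is the unit. -/
structure Casimir {L : V} (mul : L ⊗ L ⟶ L) (one : 𝟙_ V ⟶ L) where
  c : 𝟙_ V ⟶ L ⊗ L
  central : (ρ_ L).inv ≫ L ◁ c ≫ (α_ L L L).inv ≫ mul ▷ L =
    (λ_ L).inv ≫ c ▷ L ≫ (α_ L L L).hom ≫ L ◁ mul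
  c_mul : c ≫ mul = one

variable {L : V} {mul : L ⊗ L ⟶ L} {one : 𝟙_ V ⟶ L} (K : Casimir mul one)

namespace Casimir

/-- `x ↦ x c₁ ⊗ c₂` -/
def insert (P : RightMod L mul one) : P.X ⟶ P.X ⊗ L :=
  (ρ_ P.X).inv ≫ P.X ◁ K.c ≫ (α_ P.X L L).inv ≫ P.act ▷ L

theorem insert_act (P : RightMod L mul one) : K.insert P ≫ P.act = 𝟙 _ := by
  simp only [insert, Category.assoc]
  rw [P.act_act, Iso.inv_hom_id_assoc, ← MonoidalCategory.whiskerLeft_comp_assoc, K.c_mul,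
    P.act_one, Iso.inv_hom_id]

/-- Centrality makes `insert` an $L$-linear section of the action: $xl\,c_1\otimes c_2=xc_1\otimes
c_2l$. -/
theorem act_insert (P : RightMod L mul one) :
    P.act ≫ K.insert P = K.insert P ▷ L ≫ (α_ P.X L L).hom ≫ P.X ◁ mul := by
  have h1 : P.act ≫ K.insert P =
      P.X ◁ ((ρ_ L).inv ≫ L ◁ K.c ≫ (α_ L L L).inv ≫ mul ▷ L) ≫ (α_ _ _ _).inv ≫ P.act ▷ L := by
    rw [insert, rightUnitor_inv_naturality_assoc, ← whisker_exchange_assoc,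
      associator_inv_naturality_left_assoc, ← comp_whiskerRight, P.act_act, comp_whiskerRight,
      comp_whiskerRight]
    monoidal
  rw [h1, K.central]
  simp only [insert, comp_whiskerRight, MonoidalCategory.whiskerLeft_comp, Category.assoc]
  rw [associator_naturality_left_assoc, ← whisker_exchange]
  monoidal

theorem insert_nat {P Q : RightMod L mul one} (f : P ⟶ Q) :
    f.hom ≫ K.insert Q = K.insert P ≫ f.hom ▷ L := by
  simp only [insert, Category.assoc]
  rw [← comp_whiskerRight, f.linear, comp_whiskerRight, rightUnitor_inv_naturality_assoc,
    ← whisker_exchange_assoc, associator_inv_naturality_left_assoc]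

/-- The average of a morphism with respect to a Casimir element. -/
def avg {P Q : RightMod L mul one} (f : P.X ⟶ Q.X) : P ⟶ Q where
  hom := K.insert P ≫ f ▷ L ≫ Q.act
  linear := by
    rw [reassoc_of% K.act_insert]
    simp only [comp_whiskerRight, Category.assoc, Q.act_act]
    rw [whisker_exchange_assoc, associator_naturality_left_assoc]

theorem avg_hom {P Q : RightMod L mul one} (f : P.X ⟶ Q.X) :
    (K.avg f).hom = K.insert P ≫ f ▷ L ≫ Q.act := rfl

theorem avg_linear {P Q : RightMod L mul one} (f : P ⟶ Q) : (K.avg f.hom) = f := by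
  apply RightMod.Hom.ext
  rw [avg_hom, ← f.linear, reassoc_of% K.insert_act]

theorem avg_comp {P P' Q Q' : RightMod L mul one} (f : P ⟶ P') (g : P'.X ⟶ Q.X) (h : Q ⟶ Q') :
    (K.avg (f.hom ≫ g ≫ h.hom)) = f ≫ K.avg g ≫ h := by
  apply RightMod.Hom.ext
  simp only [avg_hom, RightMod.comp_hom, comp_whiskerRight, Category.assoc, h.linear]
  rw [reassoc_of% K.insert_nat]

variable {A : V} [MonObj A] (ω : L ⟶ A)

/-- The idempotent $x\otimes a\mapsto xc_1\otimes c_2a$ on $P\otimes A$ exhibits the pair as one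
with a split coequalizer, its image. Such a coequalizer is absolute, hence preserved by $-\otimes
A$, and the image inherits the action because the idempotent is $A$-linear. -/
theorem nonempty_relTensor (K : Casimir mul one) [IsIdempotentComplete V]
    (ω_mul : mul ≫ ω = (ω ⊗ₘ ω) ≫ MonObj.mul)
    (ω_one : one ≫ ω = MonObj.one) (P : RightMod L mul one) : Nonempty (RelTensor ω P) := by
  let l : L ⊗ A ⟶ A := ω ▷ A ≫ MonObj.mul
  have l_mul : mul ▷ A ≫ l = (α_ _ _ _).hom ≫ L ◁ l ≫ l := by
    simp only [l]
    rw [← comp_whiskerRight_assoc, ω_mul, MonoidalCategory.tensorHom_def]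
    simp only [comp_whiskerRight, MonoidalCategory.whiskerLeft_comp, Category.assoc,
      MonObj.mul_assoc]
    rw [whisker_exchange_assoc, whisker_exchange_assoc, associator_naturality_middle_assoc,
      associator_naturality_left_assoc]
  have l_one : one ▷ A ≫ l = (λ_ A).hom := by
    rw [← comp_whiskerRight_assoc, ω_one, MonObj.one_mul]
  have l_lin : l ▷ A ≫ MonObj.mul = (α_ _ _ _).hom ≫ L ◁ MonObj.mul ≫ l := by
    simp only [l, comp_whiskerRight, Category.assoc, MonObj.mul_assoc]
    rw [whisker_exchange_assoc]
    simp
  let f : (P.X ⊗ L) ⊗ A ⟶ P.X ⊗ A := P.act ▷ A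
  let g : (P.X ⊗ L) ⊗ A ⟶ P.X ⊗ A := (α_ P.X L A).hom ≫ P.X ◁ l
  -- $x\otimes a\mapsto x\otimes c_1\otimes c_2a$; following it by $g$ gives the identity since
  -- $c_1c_2=1$.
  let t : P.X ⊗ A ⟶ (P.X ⊗ L) ⊗ A :=
    ((ρ_ P.X).inv ≫ P.X ◁ K.c ≫ (α_ P.X L L).inv) ▷ A ≫ (α_ _ _ _).hom ≫ (P.X ⊗ L) ◁ l
  have tf : t ≫ f = K.insert P ▷ A ≫ g := by
    simp only [t, f, g, insert, comp_whiskerRight, Category.assoc]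
    rw [whisker_exchange, associator_naturality_left_assoc]
  have tg : t ≫ g = 𝟙 _ := by
    have h : t ≫ g = P.X ◁ ((λ_ A).inv ≫ K.c ▷ A ≫ (α_ _ _ _).hom ≫ L ◁ l ≫ l) := by
      simp only [t, g, comp_whiskerRight, MonoidalCategory.whiskerLeft_comp, Category.assoc]
      monoidal
    rw [h, ← l_mul, ← comp_whiskerRight_assoc, K.c_mul, l_one]
    simp
  have hg : K.insert P ▷ A ≫ f = 𝟙 _ := by rw [← comp_whiskerRight, K.insert_act, id_whiskerRight]
  -- Centrality again: $xl\,c_1\otimes c_2a=xc_1\otimes c_2la$.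
  have hfg : f ≫ K.insert P ▷ A ≫ g = g ≫ K.insert P ▷ A ≫ g := by
    simp only [f, g, Category.assoc]
    rw [← comp_whiskerRight_assoc, K.act_insert, whisker_exchange_assoc,
      ← associator_naturality_left_assoc]
    simp only [comp_whiskerRight, Category.assoc]
    rw [associator_naturality_middle_assoc, ← MonoidalCategory.whiskerLeft_comp, l_mul]
    simp only [MonoidalCategory.whiskerLeft_comp]
    monoidal
  have idem : (t ≫ f) ≫ t ≫ f = t ≫ f := by
    rw [tf, Category.assoc, ← hfg, reassoc_of% hg]
  obtain ⟨Q, i, s, his, hsi⟩ := IsIdempotentComplete.idempotents_split _ (t ≫ f) idem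
  have w : f ≫ s = g ≫ s := by
    have h : (f ≫ s) ≫ i = (g ≫ s) ≫ i := by
      rw [Category.assoc, Category.assoc, hsi, tf, hfg]
    have := h =≫ s
    simpa only [Category.assoc, his, Category.comp_id] using this
  let split : IsSplitCoequalizer f g s := ⟨i, t, w, his, tg, hsi.symm⟩
  have hl : (t ≫ f) ▷ A ≫ (α_ P.X A A).hom ≫ P.X ◁ MonObj.mul =
      (α_ P.X A A).hom ≫ P.X ◁ MonObj.mul ≫ t ≫ f := by
    simp only [tf, g, comp_whiskerRight, Category.assoc]
    rw [whisker_exchange_assoc, ← associator_naturality_left_assoc,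
      associator_naturality_middle_assoc, ← MonoidalCategory.whiskerLeft_comp, l_lin]
    simp only [MonoidalCategory.whiskerLeft_comp]
    monoidal
  have hs : s ▷ A ≫ i ▷ A ≫ (α_ P.X A A).hom ≫ P.X ◁ MonObj.mul ≫ s =
      (α_ P.X A A).hom ≫ P.X ◁ MonObj.mul ≫ s := by
    have h : (t ≫ f) ≫ s = s := by rw [← hsi, Category.assoc, his, Category.comp_id]
    rw [← comp_whiskerRight_assoc, hsi, reassoc_of% hl, ← Category.assoc t, h]
  have hi : i ▷ A ≫ s ▷ A = 𝟙 _ := by rw [← comp_whiskerRight, his, id_whiskerRight]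
  have cancel : ∀ {X Y Z : V} {j : X ⟶ Y} {r : Y ⟶ X} (_ : j ≫ r = 𝟙 _) {a b : X ⟶ Z}
      (_ : r ≫ a = r ≫ b), a = b := by
    intro X Y Z j r h a b h'
    rw [← Category.id_comp a, ← h, Category.assoc, h', reassoc_of% h]
  refine ⟨⟨⟨Q, i ▷ A ≫ (α_ P.X A A).hom ≫ P.X ◁ MonObj.mul ≫ s, ?_, ?_⟩, s, hs, w,
    split.isCoequalizer, ?_⟩⟩
  · refine cancel (show i ▷ _ ≫ s ▷ _ = 𝟙 _ by rw [← comp_whiskerRight, his, id_whiskerRight]) ?_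
    rw [← whisker_exchange_assoc, hs, associator_naturality_right_assoc,
      ← MonoidalCategory.whiskerLeft_comp_assoc, MonObj.mul_one]
    simp
  · have hi' : i ▷ A ▷ A ≫ s ▷ A ▷ A = 𝟙 _ := by rw [← comp_whiskerRight, hi, id_whiskerRight]
    refine cancel hi' ?_
    rw [← comp_whiskerRight_assoc, hs, associator_naturality_left_assoc, ← whisker_exchange_assoc,
      hs]
    simp only [comp_whiskerRight, Category.assoc]
    rw [hs]
    rw [associator_naturality_middle_assoc, ← MonoidalCategory.whiskerLeft_comp_assoc,
      MonObj.mul_assoc]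
    simp
  · have : HasSplitCoequalizer f g := ⟨_, _, ⟨split⟩⟩
    infer_instance

end Casimir

end Casimir

/-! ### The base of a weak bicomonad and its Casimir element. -/

namespace WeakBicomonad

open MonoidalCategory

variable {V : Type u} [Category.{v} V] [MonoidalCategory V] (S : WeakBicomonad V)

/-- A splitting of the idempotent `S.sq`. -/
structure Base where
  L : V
  ι : L ⟶ S.T.obj (𝟙_ V)
  π : S.T.obj (𝟙_ V) ⟶ L
  ι_π : ι ≫ π = 𝟙 L
  π_ι : π ≫ ι = S.sq

namespace Base

variable {S} (B : S.Base)

def mul : B.L ⊗ B.L ⟶ B.L := (B.ι ⊗ₘ B.ι) ≫ S.lact (𝟙_ V) ≫ B.π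

def one : 𝟙_ V ⟶ B.L := S.η ≫ B.π

def c : 𝟙_ V ⟶ B.L ⊗ B.L := S.cas ≫ (B.π ⊗ₘ B.π)

/-- The map `x ↦ ε(1₁ x) 1₂`, corestricted to the base object. -/
def κ (X : V) : S.T.obj X ⟶ B.L ⊗ X := S.κ X ≫ B.π ▷ X

theorem ι_sq : B.ι ≫ S.sq = B.ι := by
  rw [← B.π_ι, ← Category.assoc, B.ι_π, Category.id_comp]

theorem κ_ι (X : V) : B.κ X ≫ B.ι ▷ X = S.κ X := by
  rw [κ, Category.assoc, ← comp_whiskerRight, B.π_ι, S.κ_sq]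

theorem ι_lact_κ (X : V) : B.ι ▷ S.T.obj X ≫ S.lact X ≫ S.κ X =
    B.ι ▷ S.T.obj X ≫ S.T.obj (𝟙_ V) ◁ S.κ X ≫ (α_ _ _ _).inv ≫ S.lact (𝟙_ V) ▷ X := by
  rw [← B.ι_sq, comp_whiskerRight, Category.assoc, Category.assoc, S.sq_lact_κ]

/-- The base is closed under multiplication, so the projection in `mul` loses nothing: for $l$ in
the base, `sq` maps $lx$ to $l$ times the image of $x$. -/
theorem mul_ι : B.mul ≫ B.ι = (B.ι ⊗ₘ B.ι) ≫ S.lact (𝟙_ V) := by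
  have h : B.ι ▷ S.T.obj (𝟙_ V) ≫ S.lact (𝟙_ V) ≫ S.sq =
      B.ι ▷ S.T.obj (𝟙_ V) ≫ S.T.obj (𝟙_ V) ◁ S.sq ≫ S.lact (𝟙_ V) := by
    rw [sq, reassoc_of% B.ι_lact_κ, MonoidalCategory.whiskerLeft_comp, Category.assoc,
      rightUnitor_naturality]
    simp
  rw [mul, Category.assoc, Category.assoc, B.π_ι, MonoidalCategory.tensorHom_def', Category.assoc,
    h, whisker_exchange_assoc, ← MonoidalCategory.whiskerLeft_comp_assoc, B.ι_sq]
  simp [← whisker_exchange_assoc]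

theorem one_ι : B.one ≫ B.ι = S.η := by
  rw [one, Category.assoc, B.π_ι, S.η_sq]

theorem c_ι : B.c ≫ (B.ι ⊗ₘ B.ι) = S.cas := by
  rw [c, Category.assoc, MonoidalCategory.tensorHom_comp_tensorHom, B.π_ι,
    MonoidalCategory.tensorHom_def, reassoc_of% S.cas_sq_left, S.cas_sq_right]

/-- After composition with the split monomorphism `ι ⊗ₘ ι` the two sides become those of `sq_cas`
and `cas_sq`. -/
theorem c_central : (ρ_ B.L).inv ≫ B.L ◁ B.c ≫ (α_ B.L B.L B.L).inv ≫ B.mul ▷ B.L =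
    (λ_ B.L).inv ≫ B.c ▷ B.L ≫ (α_ B.L B.L B.L).hom ≫ B.L ◁ B.mul := by
  have cancel : ∀ {Z : V} {f g : Z ⟶ B.L ⊗ B.L}, f ≫ (B.ι ⊗ₘ B.ι) = g ≫ (B.ι ⊗ₘ B.ι) → f = g := by
    intro Z f g h
    have := h =≫ (B.π ⊗ₘ B.π)
    simpa only [Category.assoc, MonoidalCategory.tensorHom_comp_tensorHom, B.ι_π,
      id_tensorHom_id, Category.comp_id] using this
  have hc := B.c_ι
  have h1 : ((ρ_ B.L).inv ≫ B.L ◁ B.c ≫ (α_ B.L B.L B.L).inv ≫ B.mul ▷ B.L) ≫ (B.ι ⊗ₘ B.ι) =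
      B.ι ≫ (ρ_ _).inv ≫ S.T.obj (𝟙_ V) ◁ S.cas ≫ (α_ _ _ _).inv ≫ S.ract _ ▷ _ := by
    have h := B.mul_ι
    rw [MonoidalCategory.tensorHom_def] at h hc ⊢
    simp only [Category.assoc]
    rw [← comp_whiskerRight_assoc, h, ← lact_unit, ← hc]
    simp only [comp_whiskerRight, MonoidalCategory.whiskerLeft_comp, Category.assoc]
    rw [← whisker_exchange, rightUnitor_inv_naturality_assoc, ← whisker_exchange_assoc B.ι B.c]
    monoidal
  have h2 : ((λ_ B.L).inv ≫ B.c ▷ B.L ≫ (α_ B.L B.L B.L).hom ≫ B.L ◁ B.mul) ≫ (B.ι ⊗ₘ B.ι) =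
      B.ι ≫ (λ_ _).inv ≫ S.cas ▷ S.T.obj (𝟙_ V) ≫ (α_ _ _ _).hom ≫ _ ◁ S.ract _ := by
    have h := B.mul_ι
    rw [MonoidalCategory.tensorHom_def'] at h hc ⊢
    simp only [Category.assoc]
    rw [← MonoidalCategory.whiskerLeft_comp_assoc, h, ← lact_unit, ← hc]
    simp only [comp_whiskerRight, MonoidalCategory.whiskerLeft_comp, Category.assoc]
    rw [whisker_exchange, leftUnitor_inv_naturality_assoc, whisker_exchange_assoc B.c B.ι]
    monoidal
  apply cancel
  rw [h1, h2, ← B.ι_sq, Category.assoc, Category.assoc, S.sq_cas, S.cas_sq]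

theorem c_mul : B.c ≫ B.mul = B.one := by
  rw [mul, reassoc_of% B.c_ι, S.lact_unit, reassoc_of% S.cas_mul, one]

theorem lact_κ (X : V) : B.ι ▷ S.T.obj X ≫ S.lact X ≫ B.κ X =
    B.L ◁ B.κ X ≫ (α_ _ _ _).inv ≫ B.mul ▷ X := by
  conv_lhs => rw [κ, reassoc_of% B.ι_lact_κ, ← B.κ_ι]
  rw [mul, MonoidalCategory.tensorHom_def]
  simp only [comp_whiskerRight, MonoidalCategory.whiskerLeft_comp, Category.assoc]
  rw [← whisker_exchange_assoc]
  monoidal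

theorem η_κ {J : V} (τ : 𝟙_ V ⟶ J) :
    S.η ≫ S.T.map τ ≫ B.κ J = B.one ≫ (ρ_ _).inv ≫ B.L ◁ τ := by
  have h : S.η ≫ S.κ (𝟙_ V) = S.η ≫ (ρ_ _).inv := by
    have := S.η_sq =≫ (ρ_ _).inv
    simpa only [sq, Category.assoc, Iso.hom_inv_id, Category.comp_id] using this
  rw [κ, reassoc_of% S.κ_nat, reassoc_of% h, whisker_exchange,
    ← rightUnitor_inv_naturality_assoc, one, Category.assoc]

end Base

end WeakBicomonad

/-! ### The comonad of tensoring with a comonoid. -/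

section ComonadOfComonoid

open MonoidalCategory

variable {W : Type u} [Category.{v} W] [MonoidalCategory W] (A : W) [ComonObj A]

/-- The comultiplication of the comonad `A ⊗ -`. -/
def comonadComul (X : W) : A ⊗ X ⟶ A ⊗ A ⊗ X := ComonObj.comul ▷ X ≫ (α_ A A X).hom

/-- The counit of the comonad `A ⊗ -`. -/
def comonadCounit (X : W) : A ⊗ X ⟶ X := ComonObj.counit ▷ X ≫ (λ_ X).hom

theorem comonadComul_nat {X Y : W} (f : X ⟶ Y) :
    A ◁ f ≫ comonadComul A Y = comonadComul A X ≫ A ◁ A ◁ f := by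
  simp [comonadComul, whisker_exchange_assoc]

theorem comonadCounit_nat {X Y : W} (f : X ⟶ Y) :
    A ◁ f ≫ comonadCounit A Y = comonadCounit A X ≫ f := by
  simp [comonadCounit, whisker_exchange_assoc]

theorem comonadComul_counit (X : W) : comonadComul A X ≫ comonadCounit A (A ⊗ X) = 𝟙 _ := by
  have h := ComonObj.counit_comul A
  simp only [comonadComul, comonadCounit, Category.assoc]
  rw [← associator_naturality_left_assoc, ← comp_whiskerRight_assoc, h]
  monoidal

theorem comonadComul_map_counit (X : W) :
    comonadComul A X ≫ A ◁ comonadCounit A X = 𝟙 _ := by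
  have h := ComonObj.comul_counit A
  simp only [comonadComul, comonadCounit, Category.assoc, MonoidalCategory.whiskerLeft_comp]
  rw [← associator_naturality_middle_assoc, ← comp_whiskerRight_assoc, h]
  monoidal

theorem comonadComul_comul (X : W) :
    comonadComul A X ≫ comonadComul A (A ⊗ X) = comonadComul A X ≫ A ◁ comonadComul A X := by
  have h := ComonObj.comul_assoc A
  simp only [comonadComul, Category.assoc, MonoidalCategory.whiskerLeft_comp]
  rw [← associator_naturality_left_assoc, ← associator_naturality_middle_assoc,
    ← comp_whiskerRight_assoc, ← comp_whiskerRight_assoc, h]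
  monoidal

theorem comonadComul_assoc (X Z : W) : (α_ A X Z).inv ≫ comonadComul A X ▷ Z =
    comonadComul A (X ⊗ Z) ≫ A ◁ (α_ A X Z).inv ≫ (α_ A (A ⊗ X) Z).inv := by
  simp [comonadComul]

theorem comonadCounit_assoc (X Z : W) : (α_ A X Z).inv ≫ comonadCounit A X ▷ Z =
    comonadCounit A (X ⊗ Z) := by
  simp [comonadCounit]

end ComonadOfComonoid

/-! ### The interchange law one variable at a time, with `⊚` as the ambient tensor product. -/

section Interchange

open MonoidalCategory Duoidal

variable {C : Type u} [Category.{v} C] [Duoidal C]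

attribute [local instance] TwoMonoidal.circ

theorem bul_whiskerLeft_comp (X : C) {Y Y' Y'' : C} (f : Y ⟶ Y') (g : Y' ⟶ Y'') :
    X ◁⊡ (f ≫ g) = X ◁⊡ f ≫ X ◁⊡ g :=
  @MonoidalCategory.whiskerLeft_comp C _ TwoMonoidal.bul X _ _ _ f g

theorem bul_comp_whiskerRight {Y Y' Y'' : C} (f : Y ⟶ Y') (g : Y' ⟶ Y'') (X : C) :
    (f ≫ g) ▷⊡ X = f ▷⊡ X ≫ g ▷⊡ X :=
  @MonoidalCategory.comp_whiskerRight C _ TwoMonoidal.bul _ _ _ f g X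

theorem bul_exchange {X X' Y Y' : C} (f : X ⟶ X') (g : Y ⟶ Y') :
    X ◁⊡ g ≫ f ▷⊡ Y' = f ▷⊡ Y ≫ X' ◁⊡ g :=
  @MonoidalCategory.whisker_exchange C _ TwoMonoidal.bul _ _ _ _ f g

theorem bul_tensorHom {X X' Y Y' : C} (f : X ⟶ X') (g : Y ⟶ Y') :
    f ⊡ₘ g = f ▷⊡ Y ≫ X' ◁⊡ g :=
  @MonoidalCategory.tensorHom_def C _ TwoMonoidal.bul _ _ _ _ f g

theorem bul_id_whiskerRight (X Y : C) : 𝟙 X ▷⊡ Y = 𝟙 (X ⊡ Y) :=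
  @MonoidalCategory.id_whiskerRight C _ TwoMonoidal.bul X Y

theorem bul_whiskerLeft_id (X Y : C) : X ◁⊡ 𝟙 Y = 𝟙 (X ⊡ Y) :=
  @MonoidalCategory.whiskerLeft_id C _ TwoMonoidal.bul X Y

theorem bul_leftUnitor_nat {X Y : C} (f : X ⟶ Y) :
    unitJ C ◁⊡ f ≫ (λ⊡ Y).hom = (λ⊡ X).hom ≫ f :=
  @MonoidalCategory.leftUnitor_naturality C _ TwoMonoidal.bul _ _ f

theorem bul_rightUnitor_inv_nat {X Y : C} (f : X ⟶ Y) :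
    f ≫ (ρ⊡ Y).inv = (ρ⊡ X).inv ≫ f ▷⊡ unitJ C :=
  @MonoidalCategory.rightUnitor_inv_naturality C _ TwoMonoidal.bul _ _ f

theorem bul_rightUnitor_nat {X Y : C} (f : X ⟶ Y) :
    f ▷⊡ unitJ C ≫ (ρ⊡ Y).hom = (ρ⊡ X).hom ≫ f :=
  @MonoidalCategory.rightUnitor_naturality C _ TwoMonoidal.bul _ _ f

theorem bul_assoc_left {X X' : C} (f : X ⟶ X') (Y Z : C) :
    (f ▷⊡ Y) ▷⊡ Z ≫ (α⊡ X' Y Z).hom = (α⊡ X Y Z).hom ≫ f ▷⊡ (Y ⊡ Z) :=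
  @MonoidalCategory.associator_naturality_left C _ TwoMonoidal.bul _ _ f Y Z

theorem bul_assoc_middle (X : C) {Y Y' : C} (f : Y ⟶ Y') (Z : C) :
    (X ◁⊡ f) ▷⊡ Z ≫ (α⊡ X Y' Z).hom = (α⊡ X Y Z).hom ≫ X ◁⊡ (f ▷⊡ Z) :=
  @MonoidalCategory.associator_naturality_middle C _ TwoMonoidal.bul X _ _ f Z

theorem bul_assoc_inv_left {X X' : C} (f : X ⟶ X') (Y Z : C) :
    f ▷⊡ (Y ⊡ Z) ≫ (α⊡ X' Y Z).inv = (α⊡ X Y Z).inv ≫ (f ▷⊡ Y) ▷⊡ Z :=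
  @MonoidalCategory.associator_inv_naturality_left C _ TwoMonoidal.bul _ _ f Y Z

theorem bul_assoc_inv_right (X Y : C) {Z Z' : C} (f : Z ⟶ Z') :
    X ◁⊡ (Y ◁⊡ f) ≫ (α⊡ X Y Z').inv = (α⊡ X Y Z).inv ≫ (X ⊡ Y) ◁⊡ f :=
  @MonoidalCategory.associator_inv_naturality_right C _ TwoMonoidal.bul X Y _ _ f

theorem bul_assoc_leftUnitor {X : C} (f : X ⟶ unitJ C) (Y Z : C) :
    (f ▷⊡ Y) ▷⊡ Z ≫ (λ⊡ Y).hom ▷⊡ Z = (α⊡ X Y Z).hom ≫ f ▷⊡ (Y ⊡ Z) ≫ (λ⊡ (Y ⊡ Z)).hom := by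
  let _ : MonoidalCategory C := TwoMonoidal.bul
  exact (by simp : f ▷ Y ▷ Z ≫ (λ_ Y).hom ▷ Z = (α_ X Y Z).hom ≫ f ▷ (Y ⊗ Z) ≫ (λ_ _).hom)

theorem bul_triangle_inv (X Y : C) : X ◁⊡ (λ⊡ Y).inv = (ρ⊡ X).inv ▷⊡ Y ≫ (α⊡ X _ Y).hom := by
  let _ : MonoidalCategory C := TwoMonoidal.bul
  exact (by simp : X ◁ (λ_ Y).inv = (ρ_ X).inv ▷ Y ≫ (α_ X _ Y).hom)

theorem ζ_nat₁ {W W' : C} (f : W ⟶ W') (X Y Z : C) :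
    (f ▷⊡ X) ▷⊚ (Y ⊡ Z) ≫ ζ W' X Y Z = ζ W X Y Z ≫ (f ▷⊚ Y) ▷⊡ (X ⊚ Z) := by
  have h := ζ_natural f (𝟙 X) (𝟙 Y) (𝟙 Z)
  simpa [bul_tensorHom, bul_whiskerLeft_id, bul_id_whiskerRight] using h

theorem ζ_nat₂ (W : C) {X X' : C} (f : X ⟶ X') (Y Z : C) :
    (W ◁⊡ f) ▷⊚ (Y ⊡ Z) ≫ ζ W X' Y Z = ζ W X Y Z ≫ (W ⊚ Y) ◁⊡ (f ▷⊚ Z) := by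
  have h := ζ_natural (𝟙 W) f (𝟙 Y) (𝟙 Z)
  simpa [bul_tensorHom, bul_whiskerLeft_id, bul_id_whiskerRight] using h

theorem ζ_nat₃ (W X : C) {Y Y' : C} (f : Y ⟶ Y') (Z : C) :
    (W ⊡ X) ◁⊚ (f ▷⊡ Z) ≫ ζ W X Y' Z = ζ W X Y Z ≫ (W ◁⊚ f) ▷⊡ (X ⊚ Z) := by
  have h := ζ_natural (𝟙 W) (𝟙 X) f (𝟙 Z)
  simpa [bul_tensorHom, bul_whiskerLeft_id, bul_id_whiskerRight] using h

theorem ζ_nat₄ (W X Y : C) {Z Z' : C} (f : Z ⟶ Z') :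
    (W ⊡ X) ◁⊚ (Y ◁⊡ f) ≫ ζ W X Y Z' = ζ W X Y Z ≫ (W ⊚ Y) ◁⊡ (X ◁⊚ f) := by
  have h := ζ_natural (𝟙 W) (𝟙 X) (𝟙 Y) f
  simpa [bul_tensorHom, bul_whiskerLeft_id, bul_id_whiskerRight] using h

/-- Tensoring from the left after killing a left factor with a morphism to `J`. -/
theorem whiskerLeft_kill (X : C) {B : C} (g : B ⟶ unitJ C) (W : C) :
    X ◁⊚ (g ▷⊡ W ≫ (λ⊡ W).hom) = (λ⊡ X).inv ▷⊚ (B ⊡ W) ≫ ζ (unitJ C) X B W ≫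
      (unitJ C ◁⊚ g ≫ ϖ) ▷⊡ (X ⊚ W) ≫ (λ⊡ (X ⊚ W)).hom := by
  have h := ζ_left_J X W
  rw [bul_comp_whiskerRight, Category.assoc, ← reassoc_of% ζ_nat₃, h,
    MonoidalCategory.whiskerLeft_comp]
  simp [MonoidalCategory.tensorHom_def, whisker_exchange_assoc]

/-- Mirror of `whiskerLeft_kill`: by `ζ_left_J`, removing a factor through $J$ may be postponed
until after an interchange, at the price of a multiplication in $J$. -/
theorem whiskerRight_kill {B : C} (g : B ⟶ unitJ C) (W Z : C) :
    (g ▷⊡ W ≫ (λ⊡ W).hom) ▷⊚ Z = (B ⊡ W) ◁⊚ (λ⊡ Z).inv ≫ ζ B W (unitJ C) Z ≫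
      (g ▷⊚ unitJ C ≫ ϖ) ▷⊡ (W ⊚ Z) ≫ (λ⊡ (W ⊚ Z)).hom := by
  have h := ζ_left_J W Z
  rw [bul_comp_whiskerRight, Category.assoc, ← reassoc_of% ζ_nat₁, h, comp_whiskerRight]
  simp [MonoidalCategory.tensorHom_def', whisker_exchange_assoc]

end Interchange

/-! ### A weak bimonoid `A` makes `A ⊡ -` a weak bicomonad. -/

section Concrete

open MonoidalCategory Duoidal

attribute [local instance] TwoMonoidal.circ

variable {C : Type u} [Category.{v} C] [Duoidal C] (A : C) [WeakBimonoid A]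

/-- The functor `A ⊡ -`. -/
def bulLeft : C ⥤ C where
  obj X := A ⊡ X
  map f := A ◁⊡ f
  map_id X := bul_whiskerLeft_id A X
  map_comp f g := bul_whiskerLeft_comp A f g

/-- The unit of the lax monoidal functor `A ⊡ -`. -/
def bulUnit : unitI C ⟶ A ⊡ unitI C := δ ≫ eta A ▷⊡ unitI C

/-- The binary part of the lax monoidal functor `A ⊡ -`. -/
def bulMul (X Y : C) : (A ⊡ X) ⊚ (A ⊡ Y) ⟶ A ⊡ (X ⊚ Y) := ζ A X A Y ≫ mu A ▷⊡ (X ⊚ Y)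

/-- The comultiplication of the comonad `A ⊡ -`. -/
def bulComul (X : C) : A ⊡ X ⟶ A ⊡ A ⊡ X := Del A ▷⊡ X ≫ (α⊡ A A X).hom

/-- The counit of the comonad `A ⊡ -`. -/
def bulCounit (X : C) : A ⊡ X ⟶ X := eps A ▷⊡ X ≫ (λ⊡ X).hom

theorem bulComul_eq (X : C) :
    bulComul A X = @comonadComul C _ TwoMonoidal.bul A MonComon.comon X := rfl

theorem bulCounit_eq (X : C) :
    bulCounit A X = @comonadCounit C _ TwoMonoidal.bul A MonComon.comon X := rfl

theorem bulMul_left {X X' : C} (f : X ⟶ X') (Y : C) :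
    (A ◁⊡ f) ▷⊚ (A ⊡ Y) ≫ bulMul A X' Y = bulMul A X Y ≫ A ◁⊡ (f ▷⊚ Y) := by
  rw [bulMul, bulMul, reassoc_of% ζ_nat₂, bul_exchange, Category.assoc]

theorem bulMul_right (X : C) {Y Y' : C} (f : Y ⟶ Y') :
    (A ⊡ X) ◁⊚ (A ◁⊡ f) ≫ bulMul A X Y' = bulMul A X Y ≫ A ◁⊡ (X ◁⊚ f) := by
  rw [bulMul, bulMul, reassoc_of% ζ_nat₄, bul_exchange, Category.assoc]

theorem mu_assoc : mu A ▷⊚ A ≫ mu A = (α⊚ A A A).hom ≫ A ◁⊚ mu A ≫ mu A :=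
  @MonObj.mul_assoc C _ TwoMonoidal.circ A MonComon.mon

theorem eta_mu : eta A ▷⊚ A ≫ mu A = (λ⊚ A).hom :=
  @MonObj.one_mul C _ TwoMonoidal.circ A MonComon.mon

theorem mu_eta : A ◁⊚ eta A ≫ mu A = (ρ⊚ A).hom :=
  @MonObj.mul_one C _ TwoMonoidal.circ A MonComon.mon

theorem bulMul_bulMul (X Y Z : C) :
    bulMul A X Y ▷⊚ (A ⊡ Z) ≫ bulMul A (X ⊚ Y) Z =
      ζ A X A Y ▷⊚ (A ⊡ Z) ≫ ζ (A ⊚ A) (X ⊚ Y) A Z ≫ (mu A ▷⊚ A ≫ mu A) ▷⊡ _ := by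
  simp only [bulMul, comp_whiskerRight, Category.assoc, bul_comp_whiskerRight]
  rw [reassoc_of% ζ_nat₁]

theorem bulMul_assoc (X Y Z : C) :
    bulMul A X Y ▷⊚ (A ⊡ Z) ≫ bulMul A (X ⊚ Y) Z ≫ A ◁⊡ (α⊚ X Y Z).hom =
      (α⊚ _ _ _).hom ≫ (A ⊡ X) ◁⊚ bulMul A Y Z ≫ bulMul A X (Y ⊚ Z) := by
  have h := ζ_assoc_circ A X A Y A Z
  rw [reassoc_of% bulMul_bulMul A X Y Z, mu_assoc, bul_comp_whiskerRight, Category.assoc,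
    bul_comp_whiskerRight, Category.assoc, ← bul_exchange, ← reassoc_of% bul_exchange]
  rw [bul_tensorHom, ] at h
  simp only [bulMul, MonoidalCategory.whiskerLeft_comp, Category.assoc]
  rw [reassoc_of% ζ_nat₃, ← reassoc_of% h, ← reassoc_of% bul_exchange]

theorem bulUnit_mul (X : C) :
    bulUnit A ▷⊚ (A ⊡ X) ≫ bulMul A (unitI C) X ≫ A ◁⊡ (λ⊚ X).hom = (λ⊚ (A ⊡ X)).hom := by
  have h := ζ_left_I A X
  simp only [bulUnit, bulMul, comp_whiskerRight, Category.assoc]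
  rw [reassoc_of% ζ_nat₁, ← reassoc_of% bul_comp_whiskerRight, eta_mu, ← bul_tensorHom, h]

theorem bulMul_unit (X : C) :
    (A ⊡ X) ◁⊚ bulUnit A ≫ bulMul A X (unitI C) ≫ A ◁⊡ (ρ⊚ X).hom = (ρ⊚ (A ⊡ X)).hom := by
  have h := ζ_right_I A X
  simp only [bulUnit, bulMul, MonoidalCategory.whiskerLeft_comp, Category.assoc]
  rw [reassoc_of% ζ_nat₃, ← reassoc_of% bul_comp_whiskerRight, mu_eta, ← bul_tensorHom, h]

/-- `mul_comul` on the factors $A$, with `ζ_assoc_bul` separating the two copies of $A$ from $X$ and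
$Y$. -/
theorem bulMul_comul (X Y : C) : bulMul A X Y ≫ bulComul A (X ⊚ Y) =
    (bulComul A X ⊚ₘ bulComul A Y) ≫ bulMul A (A ⊡ X) (A ⊡ Y) ≫ A ◁⊡ bulMul A X Y := by
  have h := ζ_assoc_bul A A X A A Y
  have h' := WeakBimonoid.mul_comul (A := A)
  simp only [bulComul, bulMul, Category.assoc]
  have hD : (Del A ▷⊡ X ⊚ₘ Del A ▷⊡ Y) ≫ ζ (A ⊡ A) X (A ⊡ A) Y =
      ζ A X A Y ≫ (Del A ⊚ₘ Del A) ▷⊡ (X ⊚ Y) := by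
    rw [MonoidalCategory.tensorHom_def, MonoidalCategory.tensorHom_def, Category.assoc, ζ_nat₃,
      reassoc_of% ζ_nat₁, bul_comp_whiskerRight]
  rw [← reassoc_of% bul_comp_whiskerRight, h', bul_whiskerLeft_comp,
    ← reassoc_of% bul_exchange, ← MonoidalCategory.tensorHom_comp_tensorHom, Category.assoc,
    ← reassoc_of% h, reassoc_of% hD, bul_tensorHom]
  simp only [bul_comp_whiskerRight, Category.assoc, bul_assoc_middle]
  rw [reassoc_of% bul_assoc_left]

/-- The image in `(A ⊡ X) ⊚ (A ⊡ Y)` of the partial product. -/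
theorem comul_kill (X Y : C) :
    ((A ⊡ X) ◁⊚ bulComul A Y ≫ bulMul A X (A ⊡ Y) ≫ bulCounit A _) ≫
        (λ⊡ X).inv ▷⊚ (A ⊡ Y) ≫ ζ (unitJ C) X A Y =
      ζ A X A Y ≫ (A ◁⊚ Del A ≫ (ρ⊡ A).inv ▷⊚ (A ⊡ A) ≫ ζ A (unitJ C) A A ≫
        epsMu A ▷⊡ (unitJ C ⊚ A) ≫ (λ⊡ (unitJ C ⊚ A)).hom) ▷⊡ (X ⊚ Y) := by
  have h := ζ_assoc_bul A (unitJ C) X A A Y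
  have h' : (A ◁⊡ (λ⊡ X).inv) ▷⊚ (A ⊡ A ⊡ Y) = ((ρ⊡ A).inv ▷⊡ X) ▷⊚ _ ≫ (α⊡ A _ X).hom ▷⊚ _ := by
    rw [bul_triangle_inv, comp_whiskerRight]
  simp only [bulMul, bulCounit, bulComul, Category.assoc, bul_comp_whiskerRight,
    MonoidalCategory.whiskerLeft_comp]
  rw [bul_assoc_leftUnitor, reassoc_of% bul_assoc_left, ← bul_leftUnitor_nat,
    ← reassoc_of% ζ_nat₃, ← reassoc_of% ζ_nat₁, reassoc_of% h, ← reassoc_of% bul_exchange,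
    ← reassoc_of% bul_exchange, bul_whiskerLeft_comp, Category.assoc, ← reassoc_of% ζ_nat₂,
    h', MonoidalCategory.tensorHom_def']
  simp only [Category.assoc]
  rw [whisker_exchange_assoc]

/-- Mirror of `comul_kill`. Both gather the operations on copies of $A$ into one tensor factor, so
that the counit axioms reduce to identities not involving $X$, $Y$, $Z$. -/
theorem kill_comul (X Y : C) :
    (bulComul A X ▷⊚ (A ⊡ Y) ≫ bulMul A (A ⊡ X) Y ≫ bulCounit A _) ≫
        (A ⊡ X) ◁⊚ (λ⊡ Y).inv ≫ ζ A X (unitJ C) Y =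
      ζ A X A Y ≫ (Del A ▷⊚ A ≫ (A ⊡ A) ◁⊚ (ρ⊡ A).inv ≫ ζ A A A (unitJ C) ≫
        epsMu A ▷⊡ (A ⊚ unitJ C) ≫ (λ⊡ (A ⊚ unitJ C)).hom) ▷⊡ (X ⊚ Y) := by
  have h := ζ_assoc_bul A A X A (unitJ C) Y
  have h' : (A ⊡ A ⊡ X) ◁⊚ (A ◁⊡ (λ⊡ Y).inv) = _ ◁⊚ ((ρ⊡ A).inv ▷⊡ Y) ≫ _ ◁⊚ (α⊡ A _ Y).hom := by
    rw [bul_triangle_inv, MonoidalCategory.whiskerLeft_comp]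
  simp only [bulMul, bulCounit, bulComul, Category.assoc, bul_comp_whiskerRight,
    comp_whiskerRight]
  rw [bul_assoc_leftUnitor, reassoc_of% bul_assoc_left, ← bul_leftUnitor_nat,
    ← reassoc_of% ζ_nat₁, ← reassoc_of% ζ_nat₃, reassoc_of% h, ← reassoc_of% bul_exchange,
    ← reassoc_of% bul_exchange, bul_whiskerLeft_comp, Category.assoc, ← reassoc_of% ζ_nat₄,
    h', MonoidalCategory.tensorHom_def]
  simp only [Category.assoc]
  rw [whisker_exchange_assoc]

theorem τ_mul {X : C} (g : X ⟶ unitJ C) :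
    (λ⊚ X).inv ≫ τ ▷⊚ X ≫ unitJ C ◁⊚ g ≫ ϖ = g := by
  rw [← whisker_exchange_assoc, unit_mul, leftUnitor_naturality, Iso.inv_hom_id_assoc]

theorem mul_τ {X : C} (g : X ⟶ unitJ C) :
    (ρ⊚ X).inv ≫ X ◁⊚ τ ≫ g ▷⊚ unitJ C ≫ ϖ = g := by
  rw [whisker_exchange_assoc, mul_unit, rightUnitor_naturality, Iso.inv_hom_id_assoc]

/-- The counit axiom `lrc` with its outer factor $J$ removed by inserting the unit $\tau$ of $J$. -/
theorem counit_mul_left :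
    (A ◁⊚ Del A ≫ (ρ⊡ A).inv ▷⊚ (A ⊡ A) ≫ ζ A (unitJ C) A A ≫
        epsMu A ▷⊡ (unitJ C ⊚ A) ≫ (λ⊡ (unitJ C ⊚ A)).hom) ▷⊚ A ≫
      (α⊚ (unitJ C) A A).hom ≫ unitJ C ◁⊚ epsMu A ≫ ϖ = mu A ▷⊚ A ≫ epsMu A := by
  -- Precomposing `lrc` with `s` cancels each multiplication by $J$, since $\tau$ is neutral for
  -- $\varpi$.
  let s : A ⟶ unitJ C ⊚ A := (λ⊚ A).inv ≫ τ ▷⊚ A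
  have hs : s ▷⊚ A ≫ (α⊚ (unitJ C) A A).hom ≫ unitJ C ◁⊚ epsMu A ≫ ϖ = epsMu A := by
    conv_rhs => rw [← τ_mul (epsMu A)]
    simp [s]
  have key : s ▷⊚ A ≫ (unitJ C ⊚ A) ◁⊚ Del A ≫ (ρ⊡ (unitJ C ⊚ A)).inv ▷⊚ (A ⊡ A) ≫
      ζ (unitJ C ⊚ A) (unitJ C) A A ≫
      ((α⊚ (unitJ C) A A).hom ≫ unitJ C ◁⊚ epsMu A ≫ ϖ) ▷⊡ (unitJ C ⊚ A) ≫
      (λ⊡ (unitJ C ⊚ A)).hom =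
      A ◁⊚ Del A ≫ (ρ⊡ A).inv ▷⊚ (A ⊡ A) ≫ ζ A (unitJ C) A A ≫
        epsMu A ▷⊡ (unitJ C ⊚ A) ≫ (λ⊡ (unitJ C ⊚ A)).hom := by
    conv_rhs => rw [← hs, bul_comp_whiskerRight, Category.assoc, ← reassoc_of% ζ_nat₁,
      ← comp_whiskerRight_assoc, ← bul_rightUnitor_inv_nat, comp_whiskerRight_assoc,
      whisker_exchange_assoc]
  have h := (s ▷⊚ A) ▷⊚ A ≫= WeakBimonoid.lrc (A := A)
  have hr : (s ▷⊚ A) ▷⊚ A ≫ (α⊚ (unitJ C ⊚ A) A A).hom ≫ (unitJ C ⊚ A) ◁⊚ mu A ≫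
      (α⊚ (unitJ C) A A).hom ≫ unitJ C ◁⊚ mu A ≫ unitJ C ◁⊚ eps A ≫ ϖ =
      mu A ▷⊚ A ≫ epsMu A := by
    rw [← MonoidalCategory.whiskerLeft_comp_assoc, associator_naturality_left_assoc,
      ← whisker_exchange_assoc, hs, ← reassoc_of% mu_assoc]
  rw [← hr, ← h, ← key]
  simp only [comp_whiskerRight, bul_comp_whiskerRight, Category.assoc]

theorem counit_mul_right :
    A ◁⊚ (Del A ▷⊚ A ≫ (A ⊡ A) ◁⊚ (ρ⊡ A).inv ≫ ζ A A A (unitJ C) ≫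
        epsMu A ▷⊡ (A ⊚ unitJ C) ≫ (λ⊡ (A ⊚ unitJ C)).hom) ≫
      (α⊚ A A (unitJ C)).inv ≫ epsMu A ▷⊚ unitJ C ≫ ϖ = A ◁⊚ mu A ≫ epsMu A := by
  let s : A ⟶ A ⊚ unitJ C := (ρ⊚ A).inv ≫ A ◁⊚ τ
  have hs : A ◁⊚ s ≫ (α⊚ A A (unitJ C)).inv ≫ epsMu A ▷⊚ unitJ C ≫ ϖ = epsMu A := by
    conv_rhs => rw [← mul_τ (epsMu A)]
    simp [s]
  have key : A ◁⊚ s ≫ Del A ▷⊚ (A ⊚ unitJ C) ≫ (A ⊡ A) ◁⊚ (ρ⊡ (A ⊚ unitJ C)).inv ≫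
      ζ A A (A ⊚ unitJ C) (unitJ C) ≫
      ((α⊚ A A (unitJ C)).inv ≫ epsMu A ▷⊚ unitJ C ≫ ϖ) ▷⊡ (A ⊚ unitJ C) ≫
      (λ⊡ (A ⊚ unitJ C)).hom =
      Del A ▷⊚ A ≫ (A ⊡ A) ◁⊚ (ρ⊡ A).inv ≫ ζ A A A (unitJ C) ≫
        epsMu A ▷⊡ (A ⊚ unitJ C) ≫ (λ⊡ (A ⊚ unitJ C)).hom := by
    conv_rhs => rw [← hs, bul_comp_whiskerRight, Category.assoc, ← reassoc_of% ζ_nat₃,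
      ← MonoidalCategory.whiskerLeft_comp_assoc, ← bul_rightUnitor_inv_nat,
      MonoidalCategory.whiskerLeft_comp_assoc, ← whisker_exchange_assoc]
  have h := A ◁⊚ (A ◁⊚ s) ≫= WeakBimonoid.rrc (A := A)
  have hr : A ◁⊚ (A ◁⊚ s) ≫ (α⊚ A A (A ⊚ unitJ C)).inv ≫ mu A ▷⊚ (A ⊚ unitJ C) ≫
      (α⊚ A A (unitJ C)).inv ≫ mu A ▷⊚ unitJ C ≫ eps A ▷⊚ unitJ C ≫ ϖ =
      A ◁⊚ mu A ≫ epsMu A := by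
    rw [← comp_whiskerRight_assoc, associator_inv_naturality_right_assoc,
      whisker_exchange_assoc, hs, reassoc_of% mu_assoc, Iso.inv_hom_id_assoc]
  rw [← hr, ← h, ← key]
  simp only [bul_comp_whiskerRight, MonoidalCategory.whiskerLeft_comp, comp_whiskerRight,
    Category.assoc]

/-- Both sides factor through the same two interchanges, which separate the three copies of $A$ from
$X\circ Y\circ Z$; on the copies of $A$ the claim is `counit_mul_left`. -/
theorem bulCounit_left (X Y Z : C) :
    ((A ⊡ X) ◁⊚ bulComul A Y ≫ bulMul A X (A ⊡ Y) ≫ bulCounit A (X ⊚ A ⊡ Y)) ▷⊚ (A ⊡ Z) ≫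
      (α⊚ _ _ _).hom ≫ X ◁⊚ (bulMul A Y Z ≫ bulCounit A (Y ⊚ Z)) =
    (α⊚ _ _ _).hom ≫ (A ⊡ X) ◁⊚ bulMul A Y Z ≫ bulMul A X (Y ⊚ Z) ≫ bulCounit A _ := by
  have hq : ∀ X Y : C, bulMul A X Y ≫ bulCounit A (X ⊚ Y) =
      ζ A X A Y ≫ epsMu A ▷⊡ (X ⊚ Y) ≫ (λ⊡ _).hom := by
    intro X Y
    simp only [bulMul, bulCounit, bul_comp_whiskerRight, Category.assoc]
  have hl : (α⊚ X (A ⊡ Y) (A ⊡ Z)).hom ≫ X ◁⊚ (bulMul A Y Z ≫ bulCounit A (Y ⊚ Z)) =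
      ((λ⊡ X).inv ▷⊚ (A ⊡ Y) ≫ ζ (unitJ C) X A Y) ▷⊚ (A ⊡ Z) ≫
        ζ (unitJ C ⊚ A) (X ⊚ Y) A Z ≫
        ((α⊚ (unitJ C) A A).hom ≫ unitJ C ◁⊚ epsMu A ≫ ϖ) ▷⊡ _ ≫ (λ⊡ _).hom ≫
          (α⊚ X Y Z).hom := by
    have h := ζ_assoc_circ (unitJ C) X A Y A Z
    rw [hq, MonoidalCategory.whiskerLeft_comp, whiskerLeft_kill, whisker_exchange_assoc,
      ← associator_naturality_left_assoc, ← reassoc_of% h, ← bul_leftUnitor_nat,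
      bul_tensorHom]
    simp only [comp_whiskerRight, bul_comp_whiskerRight, Category.assoc]
    simp only [← reassoc_of% bul_exchange]
  have hm : (α⊚ _ _ _).hom ≫ (A ⊡ X) ◁⊚ bulMul A Y Z ≫ bulMul A X (Y ⊚ Z) ≫ bulCounit A _ =
      ζ A X A Y ▷⊚ (A ⊡ Z) ≫ ζ (A ⊚ A) (X ⊚ Y) A Z ≫ (mu A ▷⊚ A ≫ epsMu A) ▷⊡ _ ≫ (λ⊡ _).hom ≫
        (α⊚ X Y Z).hom := by
    have h : A ◁⊡ (α⊚ X Y Z).hom ≫ bulCounit A _ = bulCounit A _ ≫ (α⊚ X Y Z).hom :=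
      @comonadCounit_nat C _ TwoMonoidal.bul A MonComon.comon _ _ (α⊚ X Y Z).hom
    rw [← reassoc_of% bulMul_assoc, h, reassoc_of% bulMul_bulMul, bulCounit]
    simp only [bul_comp_whiskerRight, Category.assoc]
  rw [hl, ← comp_whiskerRight_assoc, comul_kill, hm, comp_whiskerRight, Category.assoc,
    reassoc_of% ζ_nat₁, ← reassoc_of% bul_comp_whiskerRight, counit_mul_left]

theorem bulCounit_right (X Y Z : C) :
    (A ⊡ X) ◁⊚ (bulComul A Y ▷⊚ (A ⊡ Z) ≫ bulMul A (A ⊡ Y) Z ≫ bulCounit A _) ≫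
      (α⊚ _ _ _).inv ≫ (bulMul A X Y ≫ bulCounit A (X ⊚ Y)) ▷⊚ Z ≫ (α⊚ _ _ _).hom =
    (A ⊡ X) ◁⊚ bulMul A Y Z ≫ bulMul A X (Y ⊚ Z) ≫ bulCounit A _ := by
  have hq : bulMul A X Y ≫ bulCounit A (X ⊚ Y) =
      ζ A X A Y ≫ epsMu A ▷⊡ (X ⊚ Y) ≫ (λ⊡ _).hom := by
    simp only [bulMul, bulCounit, bul_comp_whiskerRight, Category.assoc]
  have hl : (α⊚ _ _ _).inv ≫ (bulMul A X Y ≫ bulCounit A (X ⊚ Y)) ▷⊚ Z ≫ (α⊚ _ _ _).hom =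
      (A ⊡ X) ◁⊚ ((A ⊡ Y) ◁⊚ (λ⊡ Z).inv ≫ ζ A Y (unitJ C) Z) ≫
        ζ A X (A ⊚ unitJ C) (Y ⊚ Z) ≫
        ((α⊚ A A (unitJ C)).inv ≫ epsMu A ▷⊚ unitJ C ≫ ϖ) ▷⊡ _ ≫ (λ⊡ _).hom := by
    have h : ζ A X A Y ▷⊚ (unitJ C ⊡ Z) ≫ ζ (A ⊚ A) (X ⊚ Y) (unitJ C) Z ≫
        _ ◁⊡ (α⊚ X Y Z).hom = (α⊚ _ _ _).hom ≫ (A ⊡ X) ◁⊚ ζ A Y (unitJ C) Z ≫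
          ζ A X (A ⊚ unitJ C) (Y ⊚ Z) ≫ (α⊚ A A (unitJ C)).inv ▷⊡ _ := by
      rw [← reassoc_of% ζ_assoc_circ A X A Y (unitJ C) Z, bul_tensorHom, Category.assoc,
        bul_exchange, ← reassoc_of% bul_comp_whiskerRight, Iso.hom_inv_id, bul_id_whiskerRight,
        Category.id_comp]
    rw [hq, comp_whiskerRight, whiskerRight_kill]
    simp only [Category.assoc, MonoidalCategory.whiskerLeft_comp, bul_comp_whiskerRight]
    rw [← whisker_exchange_assoc, ← associator_inv_naturality_right_assoc, ← bul_leftUnitor_nat,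
      ← reassoc_of% bul_exchange, ← reassoc_of% bul_exchange, reassoc_of% h,
      Iso.inv_hom_id_assoc]
  have hm : (A ⊡ X) ◁⊚ bulMul A Y Z ≫ bulMul A X (Y ⊚ Z) ≫ bulCounit A _ =
      (A ⊡ X) ◁⊚ ζ A Y A Z ≫ ζ A X (A ⊚ A) (Y ⊚ Z) ≫ (A ◁⊚ mu A ≫ epsMu A) ▷⊡ _ ≫
        (λ⊡ _).hom := by
    simp only [bulMul, bulCounit, MonoidalCategory.whiskerLeft_comp, bul_comp_whiskerRight,
      Category.assoc]
    rw [reassoc_of% ζ_nat₃]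
  rw [hl, ← MonoidalCategory.whiskerLeft_comp_assoc, kill_comul, hm,
    MonoidalCategory.whiskerLeft_comp, Category.assoc,
    reassoc_of% ζ_nat₃, ← reassoc_of% bul_comp_whiskerRight, counit_mul_right]

theorem bulUnit_comul : bulUnit A ≫ bulComul A (unitI C) =
    δ ≫ DelEta A ▷⊡ unitI C ≫ (α⊡ A A (unitI C)).hom := by
  rw [bulUnit, bulComul, bul_comp_whiskerRight, Category.assoc, Category.assoc]

theorem bulComul_bulComul (X : C) :
    bulComul A X ≫ bulComul A (A ⊡ X) = bulComul A X ≫ A ◁⊡ bulComul A X :=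
  @comonadComul_comul C _ TwoMonoidal.bul A MonComon.comon X

theorem bulUnit_comul_comul : bulUnit A ≫ bulComul A _ ≫ A ◁⊡ bulComul A _ =
    δ ≫ eta A ▷⊡ unitI C ≫ Del A ▷⊡ unitI C ≫ (Del A ▷⊡ A) ▷⊡ unitI C ≫
      (α⊡ (A ⊡ A) A (unitI C)).hom ≫ (α⊡ A A (A ⊡ unitI C)).hom := by
  rw [← bulComul_bulComul, reassoc_of% bulUnit_comul, bulComul, bul_comp_whiskerRight,
    ← reassoc_of% bul_assoc_left, Category.assoc]

theorem bul_unit_right :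
    bulUnit A ≫ bulComul A _ ≫ A ◁⊡ ((ρ⊚ (A ⊡ unitI C)).inv ≫
      (A ⊡ unitI C) ◁⊚ (bulUnit A ≫ bulComul A _) ≫
      bulMul A (unitI C) (A ⊡ unitI C) ≫ A ◁⊡ (λ⊚ (A ⊡ unitI C)).hom) =
    bulUnit A ≫ bulComul A _ ≫ A ◁⊡ bulComul A _ := by
  have h := WeakBimonoid.lru (A := A)
  rw [bulUnit_comul_comul, ← h, reassoc_of% bulUnit_comul, bulUnit_comul, bulMul, bul_tensorHom]
  simp only [bul_whiskerLeft_comp, MonoidalCategory.whiskerLeft_comp, Category.assoc]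

theorem bul_unit_left :
    bulUnit A ≫ bulComul A _ ≫ A ◁⊡ ((λ⊚ (A ⊡ unitI C)).inv ≫
      (bulUnit A ≫ bulComul A _) ▷⊚ (A ⊡ unitI C) ≫
      bulMul A (A ⊡ unitI C) (unitI C) ≫ A ◁⊡ (ρ⊚ (A ⊡ unitI C)).hom) =
    bulUnit A ≫ bulComul A _ ≫ A ◁⊡ bulComul A _ := by
  have h := WeakBimonoid.llu (A := A)
  rw [bulUnit_comul_comul, ← h, reassoc_of% bulUnit_comul, bulUnit_comul, bulMul, bul_tensorHom]
  simp only [bul_whiskerLeft_comp, comp_whiskerRight, Category.assoc]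

/-- The weak bicomonad `A ⊡ -` induced by a weak bimonoid `A`. -/
def weakBicomonad : @WeakBicomonad C _ TwoMonoidal.circ where
  T := bulLeft A
  η := bulUnit A
  m := bulMul A
  d := bulComul A
  e := bulCounit A
  m_left := bulMul_left A
  m_right X _ _ f := bulMul_right A X f
  m_assoc := bulMul_assoc A
  η_m := bulUnit_mul A
  m_η := bulMul_unit A
  d_nat f := @comonadComul_nat C _ TwoMonoidal.bul A MonComon.comon _ _ f
  e_nat f := @comonadCounit_nat C _ TwoMonoidal.bul A MonComon.comon _ _ f
  d_e := @comonadComul_counit C _ TwoMonoidal.bul A MonComon.comon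
  d_map_e := @comonadComul_map_counit C _ TwoMonoidal.bul A MonComon.comon
  d_d := @comonadComul_comul C _ TwoMonoidal.bul A MonComon.comon
  m_d := bulMul_comul A
  unit_right := bul_unit_right A
  unit_left := bul_unit_left A
  counit_left := bulCounit_left A
  counit_right := bulCounit_right A

end Concrete

/-! ### Separable functors and contractible pairs. -/

section Separable

variable {C : Type u} [Category.{v} C] {D : Type u'} [Category.{v'} D]

theorem IsSeparable.reflectsIsomorphisms {F : C ⥤ D} (hF : IsSeparable F) :
    F.ReflectsIsomorphisms := by
  obtain ⟨r, hr, hn⟩ := hF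
  refine ⟨fun {X Y} f hf => ⟨r Y X (inv (F.map f)), ?_, ?_⟩⟩
  · have h := hn X Y X X f (inv (F.map f)) (𝟙 X)
    rw [IsIso.hom_inv_id_assoc, hr, Category.comp_id] at h
    exact h.symm
  · have h := hn Y Y X Y (𝟙 Y) (inv (F.map f)) f
    rw [IsIso.inv_hom_id, Category.comp_id, hr, Category.id_comp] at h
    exact h.symm

theorem IsSeparable.isContractiblePair {F : C ⥤ D} (hF : IsSeparable F) {X Y : C} {f g : X ⟶ Y}
    (h : IsContractiblePair (F.map f) (F.map g)) : IsContractiblePair f g := by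
  obtain ⟨r, hr, hn⟩ := hF
  obtain ⟨t, h1, h2⟩ := h
  refine ⟨r Y X t, ?_, ?_⟩
  · have h := hn X Y X X g t (𝟙 X)
    rw [CategoryTheory.Functor.map_id, Category.comp_id, h1, ← CategoryTheory.Functor.map_id, hr,
      Category.comp_id] at h
    exact h.symm
  · rw [← hn, ← hn, h2]

/-- Contractibility makes `f ≫ t` idempotent, and the inclusion of its image is the split equalizer.
-/
theorem IsContractiblePair.exists_isSplitEqualizer [IsIdempotentComplete C] {X Y : C}
    {f g : X ⟶ Y} (h : IsContractiblePair f g) :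
    ∃ (E : C) (e : E ⟶ X), Nonempty (IsSplitEqualizer f g e) := by
  obtain ⟨t, h1, h2⟩ := h
  obtain ⟨E, e, s, hes, hse⟩ := IsIdempotentComplete.idempotents_split X (f ≫ t)
    (by simp only [Category.assoc]; rw [reassoc_of% h2, h1, Category.comp_id])
  refine ⟨E, e, ⟨⟨s, t, ?_, hes, h1, hse.symm⟩⟩⟩
  have h : e = e ≫ f ≫ t := by rw [← hse, reassoc_of% hes]
  rw [h, Category.assoc, Category.assoc, Category.assoc, Category.assoc, h2]

end Separable

/-! ### From morphisms over `A` to morphisms of free `J`-modules. -/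

section Retraction

open MonoidalCategory Limits

variable {V : Type u} [Category.{v} V] [MonoidalCategory V] {L : V} {mul : L ⊗ L ⟶ L}
  {one : 𝟙_ V ⟶ L} {A : V} [MonObj A] {ω : L ⟶ A} {J : V}

/-- For a left `L`-linear map `κ : A ⟶ L ⊗ J`, the induced map `P ⊗_L A ⟶ P ⊗ J`. -/
theorem RelTensor.exists_toTensor {P : RightMod L mul one} (T : RelTensor ω P) (κ : A ⟶ L ⊗ J)
    (hκ : (ω ▷ A ≫ MonObj.mul) ≫ κ = L ◁ κ ≫ (α_ L L J).inv ≫ mul ▷ J) :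
    ∃ k : T.obj.X ⟶ P.X ⊗ J, T.π ≫ k = P.X ◁ κ ≫ (α_ P.X L J).inv ≫ P.act ▷ J := by
  obtain ⟨k, hk⟩ := Cofork.IsColimit.desc' T.isColimit
    (P.X ◁ κ ≫ (α_ P.X L J).inv ≫ P.act ▷ J) (by
      simp only [Category.assoc]
      rw [← MonoidalCategory.whiskerLeft_comp_assoc, hκ, ← whisker_exchange_assoc,
        associator_inv_naturality_left_assoc, ← comp_whiskerRight, P.act_act]
      simp)
  exact ⟨k, hk⟩

/-- The morphism of free `J`-modules induced by a morphism `X ⟶ Y ⊗ J`. -/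
def freeExtend [MonObj J] {X Y : V} (f : X ⟶ Y ⊗ J) :
    (freeRightMod J).obj X ⟶ (freeRightMod J).obj Y :=
  RightMod.Hom.mk (f ▷ J ≫ (α_ _ _ _).hom ≫ Y ◁ MonObj.mul) (by
    have h := (freeRightMod J).obj Y |>.act_act
    dsimp only [freeRightMod] at h ⊢
    simp only [comp_whiskerRight, Category.assoc] at h ⊢
    rw [h, whisker_exchange_assoc, ← associator_naturality_left_assoc])

theorem freeExtend_unit [MonObj J] {X Y : V} (f : X ⟶ Y) :
    freeExtend (f ≫ (ρ_ Y).inv ≫ Y ◁ (MonObj.one : 𝟙_ V ⟶ J)) = (freeRightMod J).map f := by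
  apply RightMod.Hom.ext
  dsimp only [freeExtend, freeRightMod]
  simp only [comp_whiskerRight, Category.assoc]
  rw [associator_naturality_middle_assoc, ← MonoidalCategory.whiskerLeft_comp, MonObj.one_mul]
  simp

theorem freeExtend_comp [MonObj J] {X X' Y Y' : V} (f : X' ⟶ X) (g : X ⟶ Y ⊗ J) (h : Y ⟶ Y') :
    freeExtend (f ≫ g ≫ h ▷ J) =
      (freeRightMod J).map f ≫ freeExtend g ≫ (freeRightMod J).map h := by
  apply RightMod.Hom.ext
  dsimp only [freeExtend, freeRightMod, RightMod.comp_hom]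
  simp only [comp_whiskerRight, Category.assoc]
  rw [associator_naturality_left_assoc, whisker_exchange]

/-- An $A$-linear $\varphi$ is restricted along the unit of $A$ and pushed to $Q\otimes J$ by
$\kappa$, then extended $J$-linearly. Linearity `hκ` is what lets $\kappa$ descend to the tensor
product; `hη` ensures that the map induced by $f$ is sent to $f\otimes J$. -/
theorem exists_retraction_freeRightMod [MonObj J] (T : ∀ P : RightMod L mul one, RelTensor ω P)
    (κ : A ⟶ L ⊗ J)
    (hκ : (ω ▷ A ≫ MonObj.mul) ≫ κ = L ◁ κ ≫ (α_ L L J).inv ≫ mul ▷ J)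
    (hη : (MonObj.one : 𝟙_ V ⟶ A) ≫ κ = one ≫ (ρ_ L).inv ≫ L ◁ (MonObj.one : 𝟙_ V ⟶ J)) :
    ∃ r : ∀ P Q : RightMod L mul one, ((T P).obj ⟶ (T Q).obj) →
        ((freeRightMod J).obj P.X ⟶ (freeRightMod J).obj Q.X),
      (∀ (P Q : RightMod L mul one) (f : P ⟶ Q),
        r P Q ((T P).map (T Q) f) = (freeRightMod J).map f.hom) ∧
      ∀ (P' P Q Q' : RightMod L mul one) (h : P' ⟶ P) (g : (T P).obj ⟶ (T Q).obj) (k : Q ⟶ Q'),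
        r P' Q' ((T P').map (T P) h ≫ g ≫ (T Q).map (T Q') k) =
          (freeRightMod J).map h.hom ≫ r P Q g ≫ (freeRightMod J).map k.hom := by
  choose K hK using fun P => (T P).exists_toTensor κ hκ
  have K_nat : ∀ {P Q : RightMod L mul one} (f : P ⟶ Q),
      ((T P).map (T Q) f).hom ≫ K Q = K P ≫ f.hom ▷ J := by
    intro P Q f
    apply (T P).hom_ext
    rw [reassoc_of% (T P).π_map, hK, reassoc_of% hK, ← comp_whiskerRight, f.linear,
      ← whisker_exchange_assoc, associator_inv_naturality_left_assoc, comp_whiskerRight]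
  -- The composite $P\to P\otimes A\to P\otimes_LA\to Q\otimes_LA\to Q\otimes J$.
  let r₀ : ∀ P Q : RightMod L mul one, ((T P).obj ⟶ (T Q).obj) → (P.X ⟶ Q.X ⊗ J) := fun P Q φ =>
    (ρ_ P.X).inv ≫ P.X ◁ MonObj.one ≫ (T P).π ≫ φ.hom ≫ K Q
  refine ⟨fun P Q φ => freeExtend (r₀ P Q φ), ?_, ?_⟩
  · intro P Q f
    have h : r₀ P Q ((T P).map (T Q) f) = f.hom ≫ (ρ_ Q.X).inv ≫ Q.X ◁ MonObj.one := by
      have h1 : Q.X ◁ (ρ_ L).inv ≫ (α_ Q.X L (𝟙_ V)).inv ≫ Q.act ▷ 𝟙_ V =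
          Q.act ≫ (ρ_ _).inv := by
        simp
      simp only [r₀]
      rw [reassoc_of% (T P).π_map, hK, whisker_exchange_assoc,
        ← MonoidalCategory.whiskerLeft_comp_assoc, hη, ← rightUnitor_inv_naturality_assoc]
      simp only [MonoidalCategory.whiskerLeft_comp, Category.assoc]
      rw [associator_inv_naturality_right_assoc, whisker_exchange, reassoc_of% h1,
        reassoc_of% Q.act_one, Iso.inv_hom_id_assoc]
    exact (congrArg freeExtend h).trans (freeExtend_unit _)
  · intro P' P Q Q' h g k
    have hr : r₀ P' Q' ((T P').map (T P) h ≫ g ≫ (T Q).map (T Q') k) =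
        h.hom ≫ r₀ P Q g ≫ k.hom ▷ J := by
      simp only [r₀, RightMod.comp_hom, Category.assoc]
      rw [reassoc_of% (T P').π_map, K_nat, whisker_exchange_assoc,
        ← rightUnitor_inv_naturality_assoc]
    exact (congrArg freeExtend hr).trans (freeExtend_comp _ _ _)

end Retraction

/-! ### Colinearity over `I` of the structure morphisms. -/

section Colinear

open MonoidalCategory Duoidal

attribute [local instance] TwoMonoidal.circ

variable {C : Type u} [Category.{v} C] [Duoidal C]

/-- Compatibility of a morphism with coactions of `I` on its domain and codomain. -/
def Colinear {X Y : C} (x : X ⟶ X ⊡ unitI C) (y : Y ⟶ Y ⊡ unitI C) (f : X ⟶ Y) : Prop :=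
  x ≫ f ▷⊡ unitI C = f ≫ y

/-- The diagonal coaction on `X ⊚ Y`. -/
def coactCirc {X Y : C} (x : X ⟶ X ⊡ unitI C) (y : Y ⟶ Y ⊡ unitI C) :
    X ⊚ Y ⟶ (X ⊚ Y) ⊡ unitI C :=
  (x ⊚ₘ y) ≫ ζ X (unitI C) Y (unitI C) ≫ (X ⊚ Y) ◁⊡ (λ⊚ (unitI C)).hom

/-- The coaction on `A ⊡ X`. -/
def coactBul (A : C) {X : C} (x : X ⟶ X ⊡ unitI C) : A ⊡ X ⟶ (A ⊡ X) ⊡ unitI C :=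
  A ◁⊡ x ≫ (α⊡ A X (unitI C)).inv

section

variable {X Y Z X' Y' : C} {x : X ⟶ X ⊡ unitI C} {y : Y ⟶ Y ⊡ unitI C} {z : Z ⟶ Z ⊡ unitI C}
  {x' : X' ⟶ X' ⊡ unitI C} {y' : Y' ⟶ Y' ⊡ unitI C}

theorem Colinear.comp {f : X ⟶ Y} {g : Y ⟶ Z} (hf : Colinear x y f) (hg : Colinear y z g) :
    Colinear x z (f ≫ g) := by
  unfold Colinear at *
  rw [bul_comp_whiskerRight, reassoc_of% hf, hg, Category.assoc]

theorem Colinear.inv {f : X ⟶ Y} {g : Y ⟶ X} (hf : Colinear x y f) (h : f ≫ g = 𝟙 X)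
    (h' : g ≫ f = 𝟙 Y) : Colinear y x g := by
  unfold Colinear at *
  have h1 := g ≫= hf =≫ g ▷⊡ unitI C
  rw [Category.assoc, ← bul_comp_whiskerRight, h, bul_id_whiskerRight, Category.comp_id,
    Category.assoc, reassoc_of% h'] at h1
  exact h1.symm

theorem Colinear.id : Colinear x x (𝟙 X) := by
  rw [Colinear, bul_id_whiskerRight, Category.comp_id, Category.id_comp]

theorem Colinear.circ {f : X ⟶ X'} {g : Y ⟶ Y'} (hf : Colinear x x' f) (hg : Colinear y y' g) :
    Colinear (coactCirc x y) (coactCirc x' y') (f ⊚ₘ g) := by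
  unfold Colinear at *
  have h : ζ X (unitI C) Y (unitI C) ≫ (f ⊚ₘ g) ▷⊡ _ =
      (f ▷⊡ unitI C ⊚ₘ g ▷⊡ unitI C) ≫ ζ X' (unitI C) Y' (unitI C) := by
    rw [MonoidalCategory.tensorHom_def, MonoidalCategory.tensorHom_def, bul_comp_whiskerRight,
      ← reassoc_of% ζ_nat₁, ← ζ_nat₃, Category.assoc]
  simp only [coactCirc, Category.assoc]
  rw [bul_exchange, reassoc_of% h, MonoidalCategory.tensorHom_comp_tensorHom_assoc, hf, hg,
    MonoidalCategory.tensorHom_comp_tensorHom_assoc]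

theorem Colinear.whiskerLeft {g : Y ⟶ Y'} (hg : Colinear y y' g) :
    Colinear (coactCirc x y) (coactCirc x y') (X ◁⊚ g) := by
  have := (Colinear.id (x := x)).circ hg
  rwa [id_tensorHom] at this

theorem Colinear.whiskerRight {f : X ⟶ X'} (hf : Colinear x x' f) :
    Colinear (coactCirc x y) (coactCirc x' y) (f ▷⊚ Y) := by
  have := hf.circ (Colinear.id (x := y))
  rwa [tensorHom_id] at this

theorem colinear_leftUnitor (x : X ⟶ X ⊡ unitI C) : Colinear (coactCirc δ x) x (λ⊚ X).hom := by
  have h := ζ_left_I X (unitI C)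
  rw [bul_tensorHom] at h
  rw [Colinear, coactCirc, MonoidalCategory.tensorHom_def', Category.assoc, Category.assoc,
    Category.assoc, bul_exchange, h, leftUnitor_naturality]

theorem colinear_rightUnitor (x : X ⟶ X ⊡ unitI C) : Colinear (coactCirc x δ) x (ρ⊚ X).hom := by
  have h := ζ_right_I X (unitI C)
  rw [bul_tensorHom] at h
  rw [Colinear, coactCirc, MonoidalCategory.tensorHom_def, Category.assoc, Category.assoc,
    Category.assoc, bul_exchange, unitors_equal, h, rightUnitor_naturality]

/-- After unfolding the iterated diagonal coactions this is `ζ_assoc_circ`, together with coherence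
on $I\circ I\circ I$ (`h3`). -/
theorem colinear_associator (x : X ⟶ X ⊡ unitI C) (y : Y ⟶ Y ⊡ unitI C)
    (z : Z ⟶ Z ⊡ unitI C) : Colinear (coactCirc (coactCirc x y) z) (coactCirc x (coactCirc y z))
      (α⊚ X Y Z).hom := by
  have h := ζ_assoc_circ X (unitI C) Y (unitI C) Z (unitI C)
  rw [bul_tensorHom] at h
  have h1 : coactCirc (coactCirc x y) z = ((x ⊚ₘ y) ⊚ₘ z) ≫ ζ X (unitI C) Y (unitI C) ▷⊚ _ ≫
      ζ (X ⊚ Y) (unitI C ⊚ unitI C) Z (unitI C) ≫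
      _ ◁⊡ ((λ⊚ (unitI C)).hom ▷⊚ unitI C ≫ (λ⊚ (unitI C)).hom) := by
    have h : coactCirc x y ⊚ₘ z = ((x ⊚ₘ y) ⊚ₘ z) ≫
        (ζ X (unitI C) Y (unitI C) ≫ _ ◁⊡ (λ⊚ (unitI C)).hom) ▷⊚ _ := by
      rw [← tensorHom_id, MonoidalCategory.tensorHom_comp_tensorHom, Category.comp_id, coactCirc]
    rw [coactCirc, h, comp_whiskerRight, bul_whiskerLeft_comp, Category.assoc, Category.assoc,
      reassoc_of% ζ_nat₂]
  have h2 : coactCirc x (coactCirc y z) = (x ⊚ₘ y ⊚ₘ z) ≫ _ ◁⊚ ζ Y (unitI C) Z (unitI C) ≫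
      ζ X (unitI C) (Y ⊚ Z) (unitI C ⊚ unitI C) ≫
      _ ◁⊡ (unitI C ◁⊚ (λ⊚ (unitI C)).hom ≫ (λ⊚ (unitI C)).hom) := by
    have h : x ⊚ₘ coactCirc y z = (x ⊚ₘ y ⊚ₘ z) ≫
        _ ◁⊚ (ζ Y (unitI C) Z (unitI C) ≫ _ ◁⊡ (λ⊚ (unitI C)).hom) := by
      rw [← id_tensorHom, MonoidalCategory.tensorHom_comp_tensorHom, Category.comp_id, coactCirc]
    rw [coactCirc, h, MonoidalCategory.whiskerLeft_comp, bul_whiskerLeft_comp, Category.assoc,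
      Category.assoc, reassoc_of% ζ_nat₄]
  have h3 : (λ⊚ (unitI C)).hom ▷⊚ unitI C ≫ (λ⊚ (unitI C)).hom =
      (α⊚ _ _ _).hom ≫ unitI C ◁⊚ (λ⊚ (unitI C)).hom ≫ (λ⊚ (unitI C)).hom :=
    (by monoidal : (λ_ (𝟙_ C)).hom ▷ 𝟙_ C ≫ (λ_ (𝟙_ C)).hom =
      (α_ (𝟙_ C) (𝟙_ C) (𝟙_ C)).hom ≫ 𝟙_ C ◁ (λ_ (𝟙_ C)).hom ≫ (λ_ (𝟙_ C)).hom)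
  rw [Colinear, h1, h2, h3]
  simp only [Category.assoc, bul_whiskerLeft_comp]
  rw [bul_exchange, reassoc_of% bul_exchange, reassoc_of% bul_exchange, reassoc_of% h,
    MonoidalCategory.associator_naturality_assoc]

variable (A : C) [WeakBimonoid A]

theorem colinear_bulUnit : Colinear δ (coactBul A δ) (bulUnit A) := by
  have h := comul_comul (C := C)
  rw [Colinear, bulUnit, coactBul, Category.assoc, ← reassoc_of% bul_exchange, reassoc_of% h,
    bul_assoc_inv_left, Iso.hom_inv_id_assoc, bul_comp_whiskerRight]

theorem colinear_bulComul (x : X ⟶ X ⊡ unitI C) :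
    Colinear (coactBul A x) (coactBul A (coactBul A x)) (bulComul A X) := by
  have h1 := @comonadComul_assoc C _ TwoMonoidal.bul A MonComon.comon X (unitI C)
  have h2 := @comonadComul_nat C _ TwoMonoidal.bul A MonComon.comon _ _ x
  simp only [← bulComul_eq] at h1 h2
  simp only [Colinear, coactBul]
  rw [Category.assoc, h1, reassoc_of% h2,
    bul_whiskerLeft_comp, Category.assoc]

theorem colinear_bulCounit (x : X ⟶ X ⊡ unitI C) :
    Colinear (coactBul A x) x (bulCounit A X) := by
  have h1 := @comonadCounit_assoc C _ TwoMonoidal.bul A MonComon.comon X (unitI C)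
  have h2 := @comonadCounit_nat C _ TwoMonoidal.bul A MonComon.comon _ _ x
  simp only [← bulCounit_eq] at h1 h2
  rw [Colinear, coactBul, Category.assoc, h1, h2]

/-- `ζ_assoc_bul` with $I$ as third factor lets the interchange of $A$ with $X$, $Y$ pass that of
the coactions. -/
theorem colinear_bulMul (x : X ⟶ X ⊡ unitI C) (y : Y ⟶ Y ⊡ unitI C) :
    Colinear (coactCirc (coactBul A x) (coactBul A y)) (coactBul A (coactCirc x y))
      (bulMul A X Y) := by
  have h : ((α⊡ A X (unitI C)).inv ⊚ₘ (α⊡ A Y (unitI C)).inv) ≫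
      ζ (A ⊡ X) (unitI C) (A ⊡ Y) (unitI C) ≫ ζ A X A Y ▷⊡ _ =
      ζ A (X ⊡ unitI C) A (Y ⊡ unitI C) ≫ (A ⊚ A) ◁⊡ ζ X (unitI C) Y (unitI C) ≫
        (α⊡ _ _ _).inv := by
    have h := ζ_assoc_bul A X (unitI C) A Y (unitI C) =≫ (α⊡ _ _ _).inv
    simp only [Category.assoc, Iso.hom_inv_id, Category.comp_id] at h
    rw [h, MonoidalCategory.tensorHom_comp_tensorHom_assoc, Iso.inv_hom_id, Iso.inv_hom_id,
      id_tensorHom_id, Category.id_comp]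
  have h' : (A ◁⊡ x ⊚ₘ A ◁⊡ y) ≫ ζ A (X ⊡ unitI C) A (Y ⊡ unitI C) =
      ζ A X A Y ≫ _ ◁⊡ (x ⊚ₘ y) := by
    rw [MonoidalCategory.tensorHom_def, MonoidalCategory.tensorHom_def, Category.assoc, ζ_nat₄,
      reassoc_of% ζ_nat₂, bul_whiskerLeft_comp]
  rw [Colinear]
  simp only [coactCirc, coactBul, bulMul, bul_comp_whiskerRight, bul_whiskerLeft_comp,
    Category.assoc]
  rw [← MonoidalCategory.tensorHom_comp_tensorHom, reassoc_of% bul_exchange, bul_exchange,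
    Category.assoc, reassoc_of% h, reassoc_of% h', bul_assoc_inv_right, ← reassoc_of% bul_assoc_inv_left,
    reassoc_of% bul_exchange, reassoc_of% bul_exchange]

end

end Colinear

/-! ### The base object of `A` and separability of the tensor functor. -/

section Assembly

open MonoidalCategory Duoidal

attribute [local instance] TwoMonoidal.circ

variable {C : Type u} [Category.{v} C] [Duoidal C] (A : C) [WeakBimonoid A]

/-- The left action of the monoid `A ⊡ I` on `A ⊡ X`. -/
def bulLact (X : C) : (A ⊡ unitI C) ⊚ (A ⊡ X) ⟶ A ⊡ X :=
  bulMul A (unitI C) X ≫ A ◁⊡ (λ⊚ X).hom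

/-- The map `x ↦ ε(1₁ x) 1₂`. -/
def bulκ (X : C) : A ⊡ X ⟶ (A ⊡ unitI C) ⊚ X :=
  (λ⊚ (A ⊡ X)).inv ≫ (bulUnit A ≫ bulComul A (unitI C)) ▷⊚ (A ⊡ X) ≫
    bulMul A (A ⊡ unitI C) X ≫ bulCounit A ((A ⊡ unitI C) ⊚ X)

/-- The Casimir element `ε(1₁' 1₁) 1₂' ⊗ 1₂`. -/
def bulCas : unitI C ⟶ (A ⊡ unitI C) ⊚ (A ⊡ unitI C) :=
  (bulUnit A ≫ bulComul A (unitI C)) ≫ bulκ A (A ⊡ unitI C)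

theorem sqcapL_eq : sqcapL A = bulκ A (unitI C) ≫ (ρ⊚ (A ⊡ unitI C)).hom := by
  rw [sqcapL, bulκ, bulUnit_comul, bulMul, bulCounit, bul_tensorHom, epsMu]
  simp only [comp_whiskerRight, bul_comp_whiskerRight, Category.assoc, bul_leftUnitor_nat]

theorem sqcapL_sqcapL : sqcapL A ≫ sqcapL A = sqcapL A := by
  rw [sqcapL_eq]
  exact (weakBicomonad A).sq_sq

variable {A} in
theorem colinear_bulκ {X : C} (x : X ⟶ X ⊡ unitI C) :
    Colinear (coactBul A x) (coactCirc (coactBul A δ) x) (bulκ A X) :=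
  ((colinear_leftUnitor (coactBul A x)).inv (Iso.hom_inv_id _) (Iso.inv_hom_id _)).comp
    (((colinear_bulUnit A).comp (colinear_bulComul A _)).whiskerRight.comp
      ((colinear_bulMul A _ _).comp (colinear_bulCounit A _)))

theorem colinear_sqcapL : Colinear (coactBul A δ) (coactBul A δ) (sqcapL A) := by
  rw [sqcapL_eq]
  exact (colinear_bulκ δ).comp (colinear_rightUnitor _)

theorem colinear_bulCas : Colinear δ (coactCirc (coactBul A δ) (coactBul A δ)) (bulCas A) :=
  ((colinear_bulUnit A).comp (colinear_bulComul A _)).comp (colinear_bulκ _)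

/-- By `ζ_right_J`, under $A\bullet J\cong A$ the action of $A\bullet I$ becomes multiplication in
$A$ along $A\bullet\tau$. This is the source of multiplicativity of `ω` and linearity of `toFree`.
-/
theorem bulLact_unitJ : bulLact A (unitJ C) ≫ (ρ⊡ A).hom =
    (A ◁⊡ τ ≫ (ρ⊡ A).hom ⊚ₘ (ρ⊡ A).hom) ≫ mu A := by
  have h := ζ_right_J A A
  rw [bulLact, ← unit_mul, bul_whiskerLeft_comp, Category.assoc, Category.assoc,
    ← reassoc_of% bulMul_left, bulMul, Category.assoc, ← reassoc_of% bul_exchange,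
    bul_rightUnitor_nat, reassoc_of% h]
  simp [MonoidalCategory.tensorHom_def]

theorem bulLact_map_τ : bulLact A (unitI C) ≫ A ◁⊡ τ =
    (A ⊡ unitI C) ◁⊚ (A ◁⊡ τ) ≫ bulLact A (unitJ C) := by
  rw [bulLact, bulLact, reassoc_of% bulMul_right, Category.assoc, ← bul_whiskerLeft_comp,
    ← bul_whiskerLeft_comp, leftUnitor_naturality]

theorem bulUnit_map_τ : bulUnit A ≫ A ◁⊡ τ = eta A ≫ (ρ⊡ A).inv := by
  have h := comul_counit (C := C)
  rw [bulUnit, Category.assoc, ← bul_exchange, reassoc_of% h, bul_rightUnitor_inv_nat]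

namespace BaseObject

variable {A} (B : BaseObject A)

/-- A base object of `A`, as a splitting of an idempotent of a weak bicomonad. -/
def toBase : @WeakBicomonad.Base C _ TwoMonoidal.circ (weakBicomonad A) where
  L := B.L
  ι := B.ι
  π := B.π
  ι_π := B.ι_π
  π_ι := B.π_ι.trans (sqcapL_eq A)

/-- The map `x ↦ ε(1₁ x) 1₂`, corestricted to the base object. -/
def κ (X : C) : A ⊡ X ⟶ B.L ⊚ X := bulκ A X ≫ B.π ▷⊚ X

/-- The Casimir element of the base object. -/
def c : unitI C ⟶ B.L ⊚ B.L := bulCas A ≫ (B.π ⊚ₘ B.π)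

theorem mul_eq : B.mul = (B.ι ⊚ₘ B.ι) ≫ bulLact A (unitI C) ≫ B.π := by
  rw [mul, bulLact, bulMul, bul_tensorHom]
  simp only [Category.assoc]

theorem one_eq : B.one = bulUnit A ≫ B.π := by
  rw [one, bulUnit, Category.assoc]

theorem mul_ι : B.mul ≫ B.ι = (B.ι ⊚ₘ B.ι) ≫ bulLact A (unitI C) := by
  rw [mul_eq]
  exact B.toBase.mul_ι

theorem one_ι : B.one ≫ B.ι = bulUnit A := by
  rw [one_eq]
  exact B.toBase.one_ι

/-- The separability structure of the base object. -/
def casimir : @Casimir C _ TwoMonoidal.circ B.L B.mul B.one where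
  c := B.c
  central := by
    rw [mul_eq]
    exact B.toBase.c_central
  c_mul := by
    rw [mul_eq, one_eq]
    exact B.toBase.c_mul

theorem lact_κ (X : C) : B.ι ▷⊚ (A ⊡ X) ≫ bulLact A X ≫ B.κ X =
    B.L ◁⊚ B.κ X ≫ (α⊚ B.L B.L X).inv ≫ B.mul ▷⊚ X := by
  rw [mul_eq]
  exact B.toBase.lact_κ X

theorem unit_κ : bulUnit A ≫ A ◁⊡ τ ≫ B.κ (unitJ C) =
    B.one ≫ (ρ⊚ B.L).inv ≫ B.L ◁⊚ τ := by
  rw [one_eq]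
  exact B.toBase.η_κ (τ : unitI C ⟶ unitJ C)

theorem mul_ω : B.mul ≫ B.ω = (B.ω ⊚ₘ B.ω) ≫ mu A := by
  rw [ω, reassoc_of% mul_ι, reassoc_of% bulLact_map_τ, bulLact_unitJ, ← id_tensorHom,
    MonoidalCategory.tensorHom_comp_tensorHom_assoc,
    MonoidalCategory.tensorHom_comp_tensorHom_assoc]
  simp only [Category.assoc, Category.comp_id]

theorem one_ω : B.one ≫ B.ω = eta A := by
  rw [ω, reassoc_of% one_ι, reassoc_of% bulUnit_map_τ, Iso.inv_hom_id, Category.comp_id]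

/-- The map `a ↦ ε(1₁ a) 1₂` from `A` to the free `J`-module on the base object. -/
def toFree : A ⟶ B.L ⊚ unitJ C := (ρ⊡ A).inv ≫ B.κ (unitJ C)

theorem toFree_linear : (B.ω ▷⊚ A ≫ mu A) ≫ B.toFree =
    B.L ◁⊚ B.toFree ≫ (α⊚ B.L B.L (unitJ C)).inv ≫ B.mul ▷⊚ unitJ C := by
  have h1 : B.ω ▷⊚ A ≫ mu A =
      B.L ◁⊚ (ρ⊡ A).inv ≫ B.ι ▷⊚ _ ≫ bulLact A (unitJ C) ≫ (ρ⊡ A).hom := by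
    rw [bulLact_unitJ, ω, MonoidalCategory.tensorHom_def', Category.assoc,
      ← whisker_exchange_assoc, ← MonoidalCategory.whiskerLeft_comp_assoc, Iso.inv_hom_id,
      MonoidalCategory.whiskerLeft_id, Category.id_comp, ← comp_whiskerRight_assoc]
  rw [h1, toFree, MonoidalCategory.whiskerLeft_comp]
  simp only [Category.assoc, Iso.hom_inv_id_assoc]
  rw [lact_κ]

theorem eta_toFree : eta A ≫ B.toFree = B.one ≫ (ρ⊚ B.L).inv ≫ B.L ◁⊚ τ := by
  rw [toFree, ← reassoc_of% bulUnit_map_τ, unit_κ]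

theorem coact_eq : B.coact = B.ι ≫ coactBul A δ ≫ B.π ▷⊡ unitI C := by
  simp only [coact, coactBul, Category.assoc]

theorem sqcapL_π : sqcapL A ≫ B.π = B.π := by
  rw [← B.π_ι, Category.assoc, B.ι_π, Category.comp_id]

theorem colinear_π : Colinear (coactBul A δ) B.coact B.π := by
  have h := colinear_sqcapL A
  rw [Colinear] at h ⊢
  rw [coact_eq, reassoc_of% B.π_ι, ← reassoc_of% h, ← bul_comp_whiskerRight, sqcapL_π]

theorem colinear_c : Colinear δ (coactCirc B.coact B.coact) B.c :=
  (colinear_bulCas A).comp (B.colinear_π.circ B.colinear_π)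

theorem colinear_act_iff {X : C} (act : X ⊚ B.L ⟶ X) (coact : X ⟶ X ⊡ unitI C) :
    Colinear (coactCirc coact B.coact) coact act ↔ act ≫ coact =
      (coact ⊚ₘ B.coact) ≫ ζ X (unitI C) B.L (unitI C) ≫ (act ⊡ₘ (λ⊚ (unitI C)).hom) := by
  rw [Colinear, coactCirc, bul_tensorHom, eq_comm]
  simp only [Category.assoc, bul_exchange]

theorem ModLComodI.colinear_act {B : BaseObject A} (P : B.ModLComodI) :
    Colinear (coactCirc P.coact B.coact) P.coact P.act :=
  (B.colinear_act_iff _ _).2 P.act_coact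

/-- The `I`-comodule underlying an object of `ModLComodI`. -/
def ModLComodI.toComodI {B : BaseObject A} (P : B.ModLComodI) : ComodI C :=
  @RightComod.mk C _ TwoMonoidal.bul (unitI C) (comonI C) P.X P.coact P.coact_counit P.coact_coact

/-- The morphism of `I`-comodules underlying a morphism of `ModLComodI`. -/
def ModLComodI.Hom.toComodI {B : BaseObject A} {P Q : B.ModLComodI} (f : P ⟶ Q) :
    P.toComodI ⟶ Q.toComodI :=
  @RightComod.Hom.mk C _ TwoMonoidal.bul (unitI C) (comonI C) P.toComodI Q.toComodI f.hom f.colinear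

/-- The Casimir element is colinear, being a composite of colinear maps, and so is the action of
$P$. Averaging a colinear map therefore keeps it colinear. -/
theorem colinear_insert (P : B.ModLComodI) :
    Colinear P.coact (coactCirc P.coact B.coact) (B.casimir.insert (B.forgetCoact.obj P)) :=
  ((colinear_rightUnitor _).inv (Iso.hom_inv_id _) (Iso.inv_hom_id _)).comp
    (B.colinear_c.whiskerLeft.comp
      (((colinear_associator _ _ _).inv (Iso.hom_inv_id _) (Iso.inv_hom_id _)).comp
        P.colinear_act.whiskerRight))

theorem nonempty_tensorA [IsIdempotentComplete C] (P : B.ModL) : Nonempty (B.TensorA P) :=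
  @Casimir.nonempty_relTensor C _ TwoMonoidal.circ B.L B.mul B.one A MonComon.mon B.ω
    B.casimir _ B.mul_ω B.one_ω P

/-- The retraction is the composite of `r₁`, the given retraction `r₀` and averaging. Each stage is
natural and returns a morphism of $\mathcal M^I_L$ from its image. -/
theorem isSeparable_tensorFunctor (hsep : IsSeparable (comodIToModJ C))
    (T : ∀ P : B.ModL, B.TensorA P) : IsSeparable (B.tensorFunctor T) := by
  obtain ⟨r₁, hr₁, hn₁⟩ := @exists_retraction_freeRightMod C _ TwoMonoidal.circ B.L B.mul B.one A
    MonComon.mon B.ω (unitJ C) (monJ C) T B.toFree B.toFree_linear B.eta_toFree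
  obtain ⟨r₀, hr₀, hn₀⟩ := hsep
  let s : ∀ P Q : B.ModLComodI, ((B.tensorFunctor T).obj P ⟶ (B.tensorFunctor T).obj Q) →
      (P.toComodI ⟶ Q.toComodI) := fun P Q φ =>
    r₀ P.toComodI Q.toComodI (r₁ (B.forgetCoact.obj P) (B.forgetCoact.obj Q) φ.hom)
  let u : ∀ {P Q : B.ModLComodI}, (P.toComodI ⟶ Q.toComodI) → (P.X ⟶ Q.X) :=
    fun f => @RightComod.Hom.hom C _ TwoMonoidal.bul (unitI C) (comonI C) _ _ f
  have hu : ∀ {P Q : B.ModLComodI} (f : P.toComodI ⟶ Q.toComodI),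
      Colinear P.coact Q.coact (u f) :=
    fun f => @RightComod.Hom.colinear C _ TwoMonoidal.bul (unitI C) (comonI C) _ _ f
  let a : ∀ {P Q : B.ModLComodI}, (P.X ⟶ Q.X) → (B.forgetCoact.obj P ⟶ B.forgetCoact.obj Q) :=
    fun {P Q} f => @Casimir.avg C _ TwoMonoidal.circ _ _ _ B.casimir (B.forgetCoact.obj P)
      (B.forgetCoact.obj Q) f
  -- `s P Q φ` is only colinear; averaging supplies linearity, and the last component shows that
  -- colinearity survives.
  refine ⟨fun P Q φ => ModLComodI.Hom.mk (a (u (s P Q φ))).hom (a (u (s P Q φ))).linear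
    ((B.colinear_insert P).comp ((hu (s P Q φ)).whiskerRight.comp Q.colinear_act)), ?_, ?_⟩
  · intro P Q f
    have h : s P Q ((B.tensorFunctor T).map f) = ModLComodI.Hom.toComodI f :=
      (congrArg (r₀ P.toComodI Q.toComodI) (hr₁ _ _ (B.forgetCoact.map f))).trans
        (hr₀ _ _ (ModLComodI.Hom.toComodI f))
    apply ModLComodI.Hom.ext
    dsimp only
    rw [h]
    exact congrArg RightMod.Hom.hom (B.casimir.avg_linear (B.forgetCoact.map f))
  · intro P' P Q Q' h φ k
    have hs : s P' Q' ((B.tensorFunctor T).map h ≫ φ ≫ (B.tensorFunctor T).map k) =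
        ModLComodI.Hom.toComodI h ≫ s P Q φ ≫ ModLComodI.Hom.toComodI k :=
      (congrArg (r₀ P'.toComodI Q'.toComodI)
        (hn₁ _ _ _ _ (B.forgetCoact.map h) φ.hom (B.forgetCoact.map k))).trans
        (hn₀ _ _ _ _ (ModLComodI.Hom.toComodI h) _ (ModLComodI.Hom.toComodI k))
    apply ModLComodI.Hom.ext
    dsimp only
    rw [hs]
    exact congrArg RightMod.Hom.hom
      (B.casimir.avg_comp (Q := B.forgetCoact.obj Q) (B.forgetCoact.map h) (u (s P Q φ))
        (B.forgetCoact.map k))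

/-- The retract of an object of `ModLComodI` given by a splitting of the morphism underlying an
idempotent endomorphism. -/
def ModLComodI.retract {B : BaseObject A} {P : B.ModLComodI} (p : P ⟶ P) {E : C} (i : E ⟶ P.X)
    (e : P.X ⟶ E) (hie : i ≫ e = 𝟙 E) (hei : e ≫ i = p.hom) : B.ModLComodI :=
  have hi : i ≫ p.hom = i := by rw [← hei, reassoc_of% hie]
  have he : p.hom ≫ e = e := by rw [← hei, Category.assoc, hie, Category.comp_id]
  have act_i : (i ▷⊚ B.L ≫ P.act ≫ e) ≫ i = i ▷⊚ B.L ≫ P.act := by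
    rw [Category.assoc, Category.assoc, hei, p.linear, ← comp_whiskerRight_assoc, hi]
  have coact_i : Colinear (i ≫ P.coact ≫ e ▷⊡ unitI C) P.coact i := by
    rw [Colinear, Category.assoc, Category.assoc, ← bul_comp_whiskerRight, hei, p.colinear,
      reassoc_of% hi]
  have coact_e : Colinear P.coact (i ≫ P.coact ≫ e ▷⊡ unitI C) e := by
    rw [Colinear, reassoc_of% hei, ← reassoc_of% p.colinear, ← bul_comp_whiskerRight, he]
  { X := E
    act := i ▷⊚ B.L ≫ P.act ≫ e
    act_one := by
      rw [whisker_exchange_assoc, reassoc_of% P.act_one, rightUnitor_naturality_assoc, hie,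
        Category.comp_id]
    act_act := by
      rw [← comp_whiskerRight_assoc, act_i, comp_whiskerRight_assoc, reassoc_of% P.act_act,
        whisker_exchange_assoc, associator_naturality_left_assoc]
    coact := i ≫ P.coact ≫ e ▷⊡ unitI C
    coact_counit := by
      rw [Category.assoc, Category.assoc, ← bul_exchange, reassoc_of% P.coact_counit,
        ← bul_rightUnitor_inv_nat, reassoc_of% hie]
    coact_coact := by
      rw [Category.assoc, Category.assoc, ← bul_comp_whiskerRight, ← coact_e,
        bul_comp_whiskerRight, reassoc_of% P.coact_coact, ← bul_assoc_inv_left,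
        reassoc_of% bul_exchange]
      simp only [Category.assoc]
    act_coact := (B.colinear_act_iff _ _).1
      (coact_i.whiskerRight.comp (P.colinear_act.comp coact_e)) }

/-- Split in $\mathcal M$ and transport action and coaction along the retract; both halves of the
splitting respect them because the idempotent does. -/
instance [IsIdempotentComplete C] : IsIdempotentComplete B.ModLComodI := by
  refine ⟨fun P p hp => ?_⟩
  obtain ⟨E, i, e, hie, hei⟩ :=
    IsIdempotentComplete.idempotents_split P.X p.hom (congrArg ModLComodI.Hom.hom hp)
  have hi : i ≫ p.hom = i := by rw [← hei, reassoc_of% hie]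
  have he : p.hom ≫ e = e := by rw [← hei, Category.assoc, hie, Category.comp_id]
  refine ⟨ModLComodI.retract p i e hie hei, ModLComodI.Hom.mk i ?_ ?_, ModLComodI.Hom.mk e ?_ ?_,
    ModLComodI.Hom.ext hie, ModLComodI.Hom.ext hei⟩ <;> dsimp only [ModLComodI.retract]
  · rw [Category.assoc, Category.assoc, hei, p.linear, ← comp_whiskerRight_assoc, hi]
  · rw [Category.assoc, Category.assoc, ← bul_comp_whiskerRight, hei, p.colinear,
      reassoc_of% hi]
  · rw [← comp_whiskerRight_assoc, hei, ← reassoc_of% p.linear, he]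
  · rw [reassoc_of% hei, ← reassoc_of% p.colinear, ← bul_comp_whiskerRight, he]

end BaseObject

theorem nonempty_baseObject [IsIdempotentComplete C] : Nonempty (BaseObject A) := by
  obtain ⟨L, ι, π, h, h'⟩ := IsIdempotentComplete.idempotents_split _ (sqcapL A) (sqcapL_sqcapL A)
  exact ⟨⟨L, ι, π, h, h'⟩⟩

end Assembly
end WeakBim

theorem mainTheorem8 {C : Type u} [Category.{v} C] [WeakBim.Duoidal C]
    [IsIdempotentComplete C]
    (hsep : WeakBim.IsSeparable (WeakBim.comodIToModJ C))
    (A : C) [WeakBim.WeakBimonoid A] :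
    -- the base object exists, and so do the tensor products over it
    Nonempty (WeakBim.BaseObject A) ∧
    ∀ B : WeakBim.BaseObject A,
      (∀ P : B.ModL, Nonempty (B.TensorA P)) ∧
      ∀ T : ∀ P : B.ModL, B.TensorA P,
        (B.tensorFunctor T).ReflectsIsomorphisms ∧
        ∀ (X Y : B.ModLComodI) (f g : X ⟶ Y),
          WeakBim.IsContractiblePair ((B.tensorFunctor T).map f) ((B.tensorFunctor T).map g) →
          ∃ (E : B.ModLComodI) (e : E ⟶ X), Nonempty (IsSplitEqualizer f g e) := by
  refine ⟨WeakBim.nonempty_baseObject A, fun B => ⟨B.nonempty_tensorA, fun T => ?_⟩⟩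
  have h := B.isSeparable_tensorFunctor hsep T
  exact ⟨h.reflectsIsomorphisms, fun X Y f g hfg =>
    (h.isContractiblePair hfg).exists_isSplitEqualizer⟩
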